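/- Let $\Sigma$ be a set of labels. \textbf{Transition systems.} A \emph{weak higher dimensional transition system} (WHDTS) consists of a set $S$ of states, a set $L$ of actions, a labelling map $\mu:L\to\Sigma$ and, for $n\ge1$, sets of transitions $T_n\subset S\times L^n\times S$ such that: (Multiset axiom) transitions are stable under permutation of their actions $u_1,\dots,u_n$; (Coherence axiom) if $p,q\geq 1$, $p+q<n$, and $(\alpha,u_1,\dots,u_n,\beta)$, $(\alpha,u_1,\dots,u_p,\nu_1)$, $(\nu_1,u_{p+1},\dots,u_n,\beta)$, $(\alpha,u_1,\dots,u_{p+q},\nu_2)$, $(\nu_2,u_{p+q+1},\dots,u_n,\beta)$ are transitions, then so is $(\nu_1,u_{p+1},\dots,u_{p+q},\nu_2)$. Maps are pairs of maps on states and on actions preserving labels and transitions. A \emph{higher dimensional transition system} (HDTS) is a WHDTS satisfying the Cattani--Sassone axioms: (CSA1) if $(\alpha,u,\beta)$ and $(\alpha,u',\beta)$ are transitions with $\mu(u)=\mu(u')$, then $u=u'$; (CSA2) for every transition $(\alpha,u_1,\dots,u_n,\beta)$ and $1\le p<n$ there are a unique $\nu_1$ and a unique $\nu_2$ such that $(\alpha,u_1,\dots,u_p,\nu_1)$,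 $(\nu_1,u_{p+1},\dots,u_n,\beta)$, $(\alpha,u_{p+1},\dots,u_n,\nu_2)$, $(\nu_2,u_1,\dots,u_p,\beta)$ are transitions; (CSA3) if $p,q\ge1$, $p+q<n$, and $(\alpha,u_1,\dots,u_n,\beta)$, $(\alpha,u_1,\dots,u_p,\nu_1)$, $(\nu_1,u_{p+1},\dots,u_n,\beta)$, $(\nu_1,u_{p+1},\dots,u_{p+q},\nu_2)$, $(\nu_2,u_{p+q+1},\dots,u_n,\beta)$, $(\alpha,u_1,\dots,u_{p+q},\nu_2')$, $(\nu_2',u_{p+q+1},\dots,u_n,\beta)$, $(\alpha,u_1,\dots,u_p,\nu_1')$, $(\nu_1',u_{p+1},\dots,u_{p+q},\nu_2')$ are transitions, then $\nu_1=\nu_1'$ and $\nu_2=\nu_2'$. Write $\mathbf{HDTS}\subset\mathbf{WHDTS}$ for the full subcategory of HDTS. For $a_1,\dots,a_n\in\Sigma$ the cube $C_n[a_1,\dots,a_n]$ has states $\{0,1\}^n$, actions $(a_1,1),\dots,(a_n,n)$ with $\mu(a_i,i)=a_i$, and transitions $(\epsilon,(a_{i_1},i_1),\dots,(a_{i_d},i_d),\epsilon')$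 ($d\geq 1$) with $i_1,\dots,i_d$ distinct, $\epsilon\le\epsilon'$, and $\epsilon_i\ne\epsilon'_i$ if and only if $i\in\{i_1,\dots,i_d\}$. The \emph{cubification} of a WHDTS $X$ is $\mathrm{cub}(X)=\varinjlim_{C_n[a_1,\dots,a_n]\to X}C_n[a_1,\dots,a_n]$ (colimit in $\mathbf{WHDTS}$), and $\mathbf{HDTS}[\mathrm{cub}^{-1}]$ is the categorical localization of $\mathbf{HDTS}$ at the maps $f$ such that $\mathrm{cub}(f)$ is an isomorphism. \textbf{Labelled symmetric precubical sets.} Let $\square_S$ be the category with objects $[n]=\{0<1\}^n$, $n\ge0$, and with morphisms the injective strictly increasing maps preserving pairs of elements at Hamming distance $1$. A symmetric precubical set is a presheaf of sets on $\square_S$; $\square_S[n]$ is the one represented by $[n]$, and $\partial\square_S[n]$ is obtained from it by removing all $k$-cubes with $k\ge n$. Let $!^S\Sigma$ be the symmetric precubical set with $(!^S\Sigma)_n=\Sigma^n$, where the face map in direction $i$ deletes the $i$-th letter and the symmetry maps permute the letters. Labelled symmetric precubical sets are the objects of the comma category $\square_S^{op}\mathbf{Set}\downarrow{!^S\Sigma}$;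 $\square_S[a_1,\dots,a_n]$ denotes $\square_S[n]$ with the labelling given by the cube $(a_1,\dots,a_n)$. Let $\mathbb T(K)=\varinjlim_{\square_S[a_1,\dots,a_n]\to K}C_n[a_1,\dots,a_n]$ (colimit in $\mathbf{WHDTS}$) be the colimit-preserving functor extending $\square_S[a_1,\dots,a_n]\mapsto C_n[a_1,\dots,a_n]$. Let $\mathbf{HDA}^\Sigma_{hdts}$ be the full subcategory of the labelled symmetric precubical sets $K$ such that $\mathbb T(K)$ is an HDTS and such that, for every $p\ge1$, every commutative square from $\partial\square_S[p]\subset\square_S[p]$ to $K\to{!^S\Sigma}$ admits at most one lift $\square_S[p]\to K$. \textbf{Theorem.} (1) The functor $\mathbb T$ followed by the localization functor, $\mathbf{HDA}^\Sigma_{hdts}\to\mathbf{HDTS}\to\mathbf{HDTS}[\mathrm{cub}^{-1}]$, is an equivalence of categories. (2) $\mathbf{HDA}^\Sigma_{hdts}$ is a reflective full subcategory of the category of labelled symmetric precubical sets, and it is locally finitely presentable. Hence $\mathbf{HDTS}[\mathrm{cub}^{-1}]$ is equivalent to a full reflective locally finitely presentable subcategory of the category of labelled symmetric precubical sets. (3)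 Two HDTS $X$ and $Y$ are isomorphic in $\mathbf{HDTS}[\mathrm{cub}^{-1}]$ if and only if they have the same cubes up to their actions, that is, there is a bijection $\varphi$ from the states of $X$ to the states of $Y$ such that for all $n\geq 0$, all $a_1,\dots,a_n\in\Sigma$ and every map $g$ from $\{0,1\}^n$ to the states of $X$, $g$ is the map on states of a map $C_n[a_1,\dots,a_n]\to X$ if and only if $\varphi\circ g$ is the map on states of a map $C_n[a_1,\dots,a_n]\to Y$. (4) In particular unused actions do not matter: call an action $u$ used if there is a transition $(\alpha,u,\beta)$. If two HDTS become isomorphic WHDTS after removal of their unused actions, then they are isomorphic in $\mathbf{HDTS}[\mathrm{cub}^{-1}]$. -/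

import Mathlib

open CategoryTheory Limits Opposite

universe u

namespace HDA

/-! ## Vertices of cubes and the category of symmetric boxes -/

/-- The poset `[n] = {0 < 1}ⁿ`, with `[0] = {()}`. -/
abbrev Vertex (n : ℕ) : Type := Fin n → Bool

/-- The one-to-one adjacency-preserving maps `[m] → [n]`: strictly increasing maps sending
pairs at distance `1` to pairs at distance `1`, and which are injective. -/
@[ext]
structure BoxHom (m n : ℕ) where
  toFun : Vertex m → Vertex n
  strictMono : StrictMono toFun
  adjacency : ∀ x y : Vertex m, hammingDist x y = 1 → hammingDist (toFun x) (toFun y) = 1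
  injective : Function.Injective toFun

/-- The identity of `[n]`. -/
def BoxHom.id (n : ℕ) : BoxHom n n := ⟨fun x => x, fun _ _ h => h, fun _ _ h => h, fun _ _ h => h⟩

/-- Composition of one-to-one adjacency-preserving maps: first `f`, then `g`. -/
def BoxHom.comp {m n p : ℕ} (f : BoxHom m n) (g : BoxHom n p) : BoxHom m p :=
  ⟨fun x => g.toFun (f.toFun x), fun _ _ h => g.strictMono (f.strictMono h),
    fun _ _ h => g.adjacency _ _ (f.adjacency _ _ h), fun _ _ h => f.injective (g.injective h)⟩

/-- `f` sends the edge of `[m]` which starts at `x` in the direction `i` to the edge of `[n]`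
which starts at `f x` in the direction `j`. -/
def BoxHom.EdgeDir {m n : ℕ} (f : BoxHom m n) (x : Vertex m) (i : Fin m) (j : Fin n) : Prop :=
  f.toFun x j = false ∧ f.toFun (Function.update x i true) = Function.update (f.toFun x) j true

theorem BoxHom.exists_edgeDir {m n : ℕ} (f : BoxHom m n) (x : Vertex m) (i : Fin m)
    (hx : x i = false) : ∃ j, f.EdgeDir x i j := by
  have hlt : x < Function.update x i true := by
    rw [Pi.lt_def]
    refine ⟨fun k => ?_, i, by simp [hx]⟩
    by_cases hk : k = i
    · subst hk; simp [hx]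
    · simp [hk]
  have hd : hammingDist x (Function.update x i true) = 1 := by
    rw [hammingDist, Finset.card_eq_one]
    refine ⟨i, ?_⟩
    ext k
    by_cases hk : k = i
    · subst hk; simp [hx]
    · simp [hk]
  have h1 := f.strictMono hlt
  have h2 := f.adjacency _ _ hd
  rw [hammingDist, Finset.card_eq_one] at h2
  obtain ⟨j, hj⟩ := h2
  have hne : ∀ k, f.toFun x k ≠ f.toFun (Function.update x i true) k ↔ k = j := by
    intro k
    have := Finset.ext_iff.mp hj k
    simpa using this
  have hle := h1.le j
  have hj' := (hne j).2 rfl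
  have hlow : f.toFun x j = false ∧ f.toFun (Function.update x i true) j = true := by
    revert hle hj'
    cases f.toFun x j <;> cases f.toFun (Function.update x i true) j <;> simp
  refine ⟨j, hlow.1, ?_⟩
  ext k
  by_cases hk : k = j
  · subst hk; simp [hlow.2]
  · have := mt (hne k).1 hk
    simp only [ne_eq, not_not] at this
    simp [hk, this]

theorem BoxHom.EdgeDir.step {m n : ℕ} {f : BoxHom m n} {x : Vertex m} {i k : Fin m} {a : Fin n}
    (h : f.EdgeDir x i a) (hi : x i = false) (hk : x k = false) (hik : i ≠ k) :
    f.EdgeDir (Function.update x k true) i a := by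
  obtain ⟨b, hb⟩ := f.exists_edgeDir x k hk
  obtain ⟨c, hc⟩ := f.exists_edgeDir (Function.update x k true) i (by simp [hik, hi])
  obtain ⟨d, hd⟩ := f.exists_edgeDir (Function.update x i true) k (by simp [hik.symm, hk])
  have hab : a ≠ b := by
    rintro rfl
    have := f.injective (h.2.trans hb.2.symm)
    have := congrFun this i
    simp [hik, hi] at this
  have hcomm : Function.update (Function.update x k true) i true =
      Function.update (Function.update x i true) k true := Function.update_comm hik.symm _ _ _
  have key : Function.update (Function.update (f.toFun x) b true) c true =
      Function.update (Function.update (f.toFun x) a true) d true := by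
    rw [← hb.2, ← h.2, ← hc.2, ← hd.2, hcomm]
  have hcb : c ≠ b := by
    rintro rfl
    have := hc.1
    rw [hb.2] at this
    simp at this
  have hfc : f.toFun x c = false := by
    have := hc.1
    rw [hb.2] at this
    simpa [hcb] using this
  have hca : c = a := by
    by_contra hne
    have h1 := congrFun key c
    by_cases hcd : c = d
    · subst hcd
      have h2 := congrFun key b
      simp [hcb.symm, hab.symm, hb.1] at h2
    · simp [hcd, hne, hfc] at h1
  exact hca ▸ hc

/-- A one-to-one adjacency-preserving map sends all edges with a given direction to edges
with a common direction. -/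
theorem BoxHom.exists_dir {m n : ℕ} (f : BoxHom m n) (i : Fin m) :
    ∃ j : Fin n, ∀ x : Vertex m, x i = false → f.EdgeDir x i j := by
  obtain ⟨j, hj⟩ := f.exists_edgeDir (fun _ => false) i rfl
  refine ⟨j, fun x hx => ?_⟩
  have main : ∀ s : Finset (Fin m), i ∉ s → f.EdgeDir (fun k => decide (k ∈ s)) i j := by
    intro s
    induction s using Finset.induction_on with
    | empty => intro _; simpa using hj
    | insert k s hk ih =>
      intro hi
      rw [Finset.mem_insert, not_or] at hi
      have h := (ih hi.2).step (k := k) (by simp [hi.2]) (by simp [hk]) hi.1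
      have e : Function.update (fun k => decide (k ∈ s)) k true =
          fun l => decide (l ∈ insert k s) := by
        ext l
        by_cases hl : l = k
        · subst hl; simp
        · simp [hl]
      rwa [e] at h
  have e : (fun k => decide (k ∈ Finset.univ.filter fun k => x k = true)) = x := by
    ext k; simp
  have := main (Finset.univ.filter fun k => x k = true) (by simp [hx])
  rwa [e] at this

/-- `f.dir i` is the direction in `[n]` of the images of the edges of `[m]` with direction `i`. -/
noncomputable def BoxHom.dir {m n : ℕ} (f : BoxHom m n) (i : Fin m) : Fin n :=
  (f.exists_dir i).choose

theorem BoxHom.edgeDir_dir {m n : ℕ} (f : BoxHom m n) (i : Fin m) (x : Vertex m)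
    (hx : x i = false) : f.EdgeDir x i (f.dir i) :=
  (f.exists_dir i).choose_spec x hx

theorem BoxHom.dir_eq {m n : ℕ} (f : BoxHom m n) (i : Fin m) (j : Fin n) (x : Vertex m)
    (hx : x i = false) (h : f.EdgeDir x i j) : f.dir i = j := by
  have h' := f.edgeDir_dir i x hx
  by_contra hne
  have := congrFun (h'.2.symm.trans h.2) j
  simp [Ne.symm hne, h.1] at this

theorem BoxHom.dir_id {n : ℕ} (i : Fin n) : (BoxHom.id n).dir i = i :=
  (BoxHom.id n).dir_eq i i (fun _ => false) rfl ⟨rfl, rfl⟩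

theorem BoxHom.dir_comp {m n p : ℕ} (f : BoxHom m n) (g : BoxHom n p) (i : Fin m) :
    (f.comp g).dir i = g.dir (f.dir i) := by
  have h1 := f.edgeDir_dir i (fun _ => false) rfl
  have h2 := g.edgeDir_dir (f.dir i) _ h1.1
  refine (f.comp g).dir_eq i _ (fun _ => false) rfl ⟨h2.1, ?_⟩
  exact (congrArg g.toFun h1.2).trans h2.2

theorem BoxHom.apply_dir {m n : ℕ} (f : BoxHom m n) (x : Vertex m) (i : Fin m) :
    f.toFun x (f.dir i) = x i := by
  cases hx : x i with
  | false => exact (f.edgeDir_dir i x hx).1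
  | true =>
    have h := (f.edgeDir_dir i (Function.update x i false) (by simp)).2
    have e : Function.update (Function.update x i false) i true = x := by
      rw [Function.update_idem, ← hx, Function.update_eq_self]
    rw [e] at h
    rw [h]; simp

theorem BoxHom.dir_injective {m n : ℕ} (f : BoxHom m n) : Function.Injective f.dir := by
  intro i k h
  have h1 := f.apply_dir (fun l => decide (l = i)) i
  have h2 := f.apply_dir (fun l => decide (l = i)) k
  rw [← h, h1] at h2
  simpa [eq_comm] using h2

theorem BoxHom.le {m n : ℕ} (f : BoxHom m n) : m ≤ n := by
  simpa using Fintype.card_le_of_injective _ f.dir_injective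

/-- The coordinates which are not directions of `f` are constant. -/
theorem BoxHom.apply_of_notMem {m n : ℕ} (f : BoxHom m n) (x : Vertex m) (j : Fin n)
    (hj : ∀ i, f.dir i ≠ j) : f.toFun x j = f.toFun (fun _ => false) j := by
  have main : ∀ s : Finset (Fin m),
      f.toFun (fun k => decide (k ∈ s)) j = f.toFun (fun _ => false) j := by
    intro s
    induction s using Finset.induction_on with
    | empty => simp
    | insert k s hk ih =>
      have h := (f.edgeDir_dir k (fun k => decide (k ∈ s)) (by simp [hk])).2
      have e : Function.update (fun k => decide (k ∈ s)) k true =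
          fun l => decide (l ∈ insert k s) := by
        ext l
        by_cases hl : l = k
        · subst hl; simp
        · simp [hl]
      rw [e] at h
      rw [h, Function.update_of_ne (hj k).symm, ih]
  have e : (fun k => decide (k ∈ Finset.univ.filter fun k => x k = true)) = x := by
    ext k; simp
  have := main (Finset.univ.filter fun k => x k = true)
  rwa [e] at this

/-- The category `□_S`: objects the posets `[n]`, `n ≥ 0`, morphisms the one-to-one
adjacency-preserving maps. -/
structure Box where
  dim : ℕ

instance : Category.{0} Box where
  Hom X Y := BoxHom X.dim Y.dim
  id X := BoxHom.id X.dim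
  comp f g := BoxHom.comp f g

/-! ## Labelled symmetric precubical sets -/

/-- Symmetric precubical sets. -/
abbrev SymPrecubicalSet := Boxᵒᵖ ⥤ Type u

/-- The symmetric precubical set `!^S Lab` of labels: its `n`-cubes are the words of length `n`,
a face map removes the corresponding letter, a symmetry map permutes the letters. -/
noncomputable def bang (Lab : Type u) : SymPrecubicalSet.{u} where
  obj X := Fin X.unop.dim → Lab
  map f := TypeCat.ofHom fun a i => a (BoxHom.dir f.unop i)
  map_id X := by
    ext a i
    exact congrArg a (BoxHom.dir_id i)
  map_comp f g := by
    ext a i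
    exact congrArg a (BoxHom.dir_comp g.unop f.unop i)

/-- Labelled symmetric precubical sets: the comma category over `!^S Lab`. -/
abbrev LabSymPrecubicalSet (Lab : Type u) := Over (bang Lab)

/-- The `n`-dimensional symmetric cube `□_S[n]`. -/
abbrev stdCube (n : ℕ) : SymPrecubicalSet.{u} := uliftYoneda.{u}.obj (Box.mk n)

/-- The boundary `∂□_S[n]` of the `n`-cube: its `k`-cubes are those of `□_S[n]` if `k < n`,
and there are none if `k ≥ n`. -/
def boundary (n : ℕ) : Subfunctor (stdCube.{u} n) where
  obj X := {_f | X.unop.dim < n}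
  map f _ h := lt_of_le_of_lt (BoxHom.le f.unop) h

/-- For a given `p`, every labelled `p`-shell of `K` has at most one filler. -/
def AtMostOneFiller {Lab : Type u} (p : ℕ) (K : LabSymPrecubicalSet Lab) : Prop :=
  ∀ (f : (boundary.{u} p).toFunctor ⟶ K.left) (g : stdCube.{u} p ⟶ bang Lab)
    (sq : CommSq f (boundary.{u} p).ι K.hom g), Subsingleton sq.LiftStruct

/-- The paradigm of higher dimensional automata. -/
def HDAParadigm {Lab : Type u} (K : LabSymPrecubicalSet Lab) : Prop :=
  ∀ p, 2 ≤ p → AtMostOneFiller p K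

/-- The category of labelled cubes `□_S[a₁,…,aₙ]`, described through the Yoneda lemma:
a morphism is a map `f` of `□_S` with `f^*(b₁,…,bₙ) = (a₁,…,aₘ)`. -/
structure LabCube (Lab : Type u) where
  dim : ℕ
  label : Fin dim → Lab

/-- Morphisms of labelled cubes. -/
@[ext]
structure LabCube.Hom {Lab : Type u} (A B : LabCube Lab) where
  box : BoxHom A.dim B.dim
  label_eq : ∀ i, B.label (box.dir i) = A.label i

instance (Lab : Type u) : Category.{0} (LabCube Lab) where
  Hom A B := LabCube.Hom A B
  id A := ⟨BoxHom.id A.dim, fun i => by rw [BoxHom.dir_id]⟩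
  comp f g := ⟨f.box.comp g.box, fun i => by rw [BoxHom.dir_comp, g.label_eq, f.label_eq]⟩

/-- The labelled cube `□_S[a₁,…,aₙ] : □_S[n] ⟶ !^S Lab`, `f ↦ f^*(a₁,…,aₙ)`, as a functor. -/
noncomputable def labCubeFunctor (Lab : Type u) : LabCube Lab ⥤ LabSymPrecubicalSet Lab where
  obj A := Over.mk (Y := stdCube.{u} A.dim)
    { app := fun X => TypeCat.ofHom fun f i => A.label (BoxHom.dir f.down i)
      naturality := fun X Y g => by
        ext f
        funext i
        exact congrArg A.label (BoxHom.dir_comp g.unop f.down i) }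
  map {A B} f := Over.homMk (uliftYoneda.{u}.map (X := Box.mk A.dim) (Y := Box.mk B.dim) f.box) (by
    ext X h
    funext i
    exact (congrArg B.label (BoxHom.dir_comp h.down f.box i)).trans (f.label_eq _))

/-! ## Weak higher dimensional transition systems -/

theorem map_ne_nil {A B : Type*} (f : A → B) {l : List A} (h : l ≠ []) : l.map f ≠ [] :=
  mt List.map_eq_nil_iff.1 h

/-- Weak higher dimensional transition systems labelled by `Lab`. The tuple `(α, u₁, …, uₙ, β)`
is a transition when `trans α [u₁, …, uₙ] β` holds; transitions have dimension `n ≥ 1`. -/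
structure WHDTS (Lab : Type u) where
  State : Type u
  Action : Type u
  label : Action → Lab
  trans : State → List Action → State → Prop
  ne_nil : ∀ {α l β}, trans α l β → l ≠ []
  multiset : ∀ {α l l' β}, l.Perm l' → trans α l β → trans α l' β
  coherence : ∀ {α β ν₁ ν₂ l₁ l₂ l₃}, l₁ ≠ [] → l₂ ≠ [] → l₃ ≠ [] →
    trans α (l₁ ++ l₂ ++ l₃) β → trans α l₁ ν₁ → trans ν₁ (l₂ ++ l₃) β →
    trans α (l₁ ++ l₂) ν₂ → trans ν₂ l₃ β → trans ν₁ l₂ ν₂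

/-- Maps of weak higher dimensional transition systems. -/
@[ext]
structure WHDTS.Hom {Lab : Type u} (X Y : WHDTS Lab) where
  onState : X.State → Y.State
  onAction : X.Action → Y.Action
  label_eq : ∀ a, Y.label (onAction a) = X.label a
  map_trans : ∀ α l β, X.trans α l β → Y.trans (onState α) (l.map onAction) (onState β)

instance (Lab : Type u) : Category.{u} (WHDTS Lab) where
  Hom X Y := WHDTS.Hom X Y
  id X := ⟨fun s => s, fun a => a, fun _ => rfl, fun _ _ _ h => by simpa using h⟩
  comp f g := ⟨fun s => g.onState (f.onState s), fun a => g.onAction (f.onAction a),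
    fun a => by rw [g.label_eq, f.label_eq],
    fun α l β h => by
      have h' := g.map_trans _ _ _ (f.map_trans α l β h)
      rw [List.map_map] at h'
      exact h'⟩

/-- First Cattani-Sassone axiom. -/
def WHDTS.CSA1 {Lab : Type u} (X : WHDTS Lab) : Prop :=
  ∀ α β u u', X.trans α [u] β → X.trans α [u'] β → X.label u = X.label u' → u = u'

/-- Second Cattani-Sassone axiom. -/
def WHDTS.CSA2 {Lab : Type u} (X : WHDTS Lab) : Prop :=
  ∀ α β l₁ l₂, l₁ ≠ [] → l₂ ≠ [] → X.trans α (l₁ ++ l₂) β →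
    (∃! ν₁, X.trans α l₁ ν₁ ∧ X.trans ν₁ l₂ β) ∧ (∃! ν₂, X.trans α l₂ ν₂ ∧ X.trans ν₂ l₁ β)

/-- Third Cattani-Sassone axiom. -/
def WHDTS.CSA3 {Lab : Type u} (X : WHDTS Lab) : Prop :=
  ∀ α β ν₁ ν₂ ν₁' ν₂' l₁ l₂ l₃, l₁ ≠ [] → l₂ ≠ [] → l₃ ≠ [] →
    X.trans α (l₁ ++ l₂ ++ l₃) β → X.trans α l₁ ν₁ → X.trans ν₁ (l₂ ++ l₃) β →
    X.trans ν₁ l₂ ν₂ → X.trans ν₂ l₃ β → X.trans α (l₁ ++ l₂) ν₂' → X.trans ν₂' l₃ β →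
    X.trans α l₁ ν₁' → X.trans ν₁' l₂ ν₂' → ν₁ = ν₁' ∧ ν₂ = ν₂'

/-- The Coherence axiom follows from the Multiset axiom, CSA2 and CSA3, so higher dimensional
transition systems are exactly the weak ones which satisfy the three Cattani-Sassone axioms. -/
theorem coherence_of_cattaniSassone {S L : Type u} (trans : S → List L → S → Prop)
    (csa2 : ∀ α β l₁ l₂, l₁ ≠ [] → l₂ ≠ [] → trans α (l₁ ++ l₂) β →
      (∃! ν₁, trans α l₁ ν₁ ∧ trans ν₁ l₂ β) ∧ (∃! ν₂, trans α l₂ ν₂ ∧ trans ν₂ l₁ β))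
    (csa3 : ∀ α β ν₁ ν₂ ν₁' ν₂' l₁ l₂ l₃, l₁ ≠ [] → l₂ ≠ [] → l₃ ≠ [] →
      trans α (l₁ ++ l₂ ++ l₃) β → trans α l₁ ν₁ → trans ν₁ (l₂ ++ l₃) β →
      trans ν₁ l₂ ν₂ → trans ν₂ l₃ β → trans α (l₁ ++ l₂) ν₂' → trans ν₂' l₃ β →
      trans α l₁ ν₁' → trans ν₁' l₂ ν₂' → ν₁ = ν₁' ∧ ν₂ = ν₂')
    {α β ν₁ ν₂ : S} {l₁ l₂ l₃ : List L} (h₁ : l₁ ≠ []) (h₂ : l₂ ≠ []) (h₃ : l₃ ≠ [])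
    (t : trans α (l₁ ++ l₂ ++ l₃) β) (t₁ : trans α l₁ ν₁) (t₂ : trans ν₁ (l₂ ++ l₃) β)
    (t₃ : trans α (l₁ ++ l₂) ν₂) (t₄ : trans ν₂ l₃ β) : trans ν₁ l₂ ν₂ := by
  obtain ⟨⟨ν₁', ⟨p₁, p₂⟩, _⟩, _⟩ := csa2 _ _ _ _ h₁ h₂ t₃
  obtain ⟨⟨ν₂', ⟨q₁, q₂⟩, _⟩, _⟩ := csa2 _ _ _ _ h₂ h₃ t₂
  obtain ⟨_, rfl⟩ := csa3 _ _ _ _ _ _ _ _ _ h₁ h₂ h₃ t t₁ t₂ q₁ q₂ t₃ t₄ p₁ p₂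
  exact q₁

/-- Higher dimensional transition systems. -/
def isHDTS (Lab : Type u) : ObjectProperty (WHDTS Lab) :=
  fun X => X.CSA1 ∧ X.CSA2 ∧ X.CSA3

/-- The full subcategory of higher dimensional transition systems. -/
abbrev HDTS (Lab : Type u) := (isHDTS Lab).FullSubcategory

/-! ## Colimits of weak higher dimensional transition systems -/

/-- The set of states, as a functor. -/
def WHDTS.stateFunctor (Lab : Type u) : WHDTS Lab ⥤ Type u where
  obj X := X.State
  map f := TypeCat.ofHom f.onState

/-- The set of actions, as a functor. -/
def WHDTS.actionFunctor (Lab : Type u) : WHDTS Lab ⥤ Type u where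
  obj X := X.Action
  map f := TypeCat.ofHom f.onAction

section Colimits

variable {Lab : Type u} {J : Type u} [Category.{u} J] (F : J ⥤ WHDTS Lab)

/-- The closure under the Multiset and Coherence axioms of the union of the images of the
transitions. -/
inductive WHDTS.ColimTrans : colimit (F ⋙ WHDTS.stateFunctor Lab) →
    List (colimit (F ⋙ WHDTS.actionFunctor Lab) : Type u) →
    colimit (F ⋙ WHDTS.stateFunctor Lab) → Prop
  | of (j : J) (α : (F.obj j).State) (l : List (F.obj j).Action) (β : (F.obj j).State) :
      (F.obj j).trans α l β → ColimTrans (colimit.ι (F ⋙ WHDTS.stateFunctor Lab) j α)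
        (l.map fun a => colimit.ι (F ⋙ WHDTS.actionFunctor Lab) j a)
        (colimit.ι (F ⋙ WHDTS.stateFunctor Lab) j β)
  | multiset {α l l' β} : l.Perm l' → ColimTrans α l β → ColimTrans α l' β
  | coherence {α β ν₁ ν₂ l₁ l₂ l₃} : l₁ ≠ [] → l₂ ≠ [] → l₃ ≠ [] →
      ColimTrans α (l₁ ++ l₂ ++ l₃) β → ColimTrans α l₁ ν₁ → ColimTrans ν₁ (l₂ ++ l₃) β →
      ColimTrans α (l₁ ++ l₂) ν₂ → ColimTrans ν₂ l₃ β → ColimTrans ν₁ l₂ ν₂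

theorem WHDTS.ColimTrans.desc (Y : WHDTS Lab)
    (fS : colimit (F ⋙ WHDTS.stateFunctor Lab) → Y.State)
    (fA : (colimit (F ⋙ WHDTS.actionFunctor Lab) : Type u) → Y.Action)
    (h : ∀ (j : J) (α : (F.obj j).State) (l : List (F.obj j).Action) (β : (F.obj j).State),
      (F.obj j).trans α l β → Y.trans (fS (colimit.ι (F ⋙ WHDTS.stateFunctor Lab) j α))
        (l.map fun a => fA (colimit.ι (F ⋙ WHDTS.actionFunctor Lab) j a))
        (fS (colimit.ι (F ⋙ WHDTS.stateFunctor Lab) j β)))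
    (α) (l) (β) (t : WHDTS.ColimTrans F α l β) : Y.trans (fS α) (l.map fA) (fS β) := by
  induction t with
  | of j α l β t =>
    exact (congrArg (fun w => Y.trans _ w _) List.map_map).mpr (h j α l β t)
  | multiset hp _ ih => exact Y.multiset (hp.map _) ih
  | coherence h1 h2 h3 _ _ _ _ _ i1 i2 i3 i4 i5 =>
    rw [List.map_append, List.map_append] at i1
    rw [List.map_append] at i3 i4
    exact Y.coherence (map_ne_nil _ h1) (map_ne_nil _ h2) (map_ne_nil _ h3) i1 i2 i3 i4 i5

/-- The cocone of labelling maps. -/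
noncomputable def WHDTS.labelCocone : Cocone (F ⋙ WHDTS.actionFunctor Lab) where
  pt := Lab
  ι :=
    { app := fun j => TypeCat.ofHom (F.obj j).label
      naturality := fun j k f => by
        ext a
        exact (F.map f).label_eq a }

/-- The colimit. -/
noncomputable def WHDTS.colim : WHDTS Lab where
  State := colimit (F ⋙ WHDTS.stateFunctor Lab)
  Action := colimit (F ⋙ WHDTS.actionFunctor Lab)
  label := fun a => colimit.desc _ (WHDTS.labelCocone F) a
  trans := WHDTS.ColimTrans F
  ne_nil := by
    intro α l β h
    induction h with
    | of j α l β h => exact map_ne_nil _ ((F.obj j).ne_nil h)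
    | multiset hp _ ih => exact fun h0 => ih (by subst h0; exact hp.eq_nil)
    | coherence _ h2 => exact h2
  multiset := WHDTS.ColimTrans.multiset
  coherence := WHDTS.ColimTrans.coherence

/-- The colimit cocone. -/
noncomputable def WHDTS.colimCocone : Cocone F where
  pt := WHDTS.colim F
  ι :=
    { app := fun j =>
        { onState := fun s => colimit.ι (F ⋙ WHDTS.stateFunctor Lab) j s
          onAction := fun a => colimit.ι (F ⋙ WHDTS.actionFunctor Lab) j a
          label_eq := fun a =>
            ConcreteCategory.congr_hom (colimit.ι_desc (WHDTS.labelCocone F) j) a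
          map_trans := fun α l β h => WHDTS.ColimTrans.of j α l β h }
      naturality := fun _ _ f => WHDTS.Hom.ext
        (funext fun s =>
          ConcreteCategory.congr_hom (colimit.w (F ⋙ WHDTS.stateFunctor Lab) f) s)
        (funext fun a =>
          ConcreteCategory.congr_hom (colimit.w (F ⋙ WHDTS.actionFunctor Lab) f) a) }

/-- The map out of the colimit which is induced by a cocone. -/
noncomputable def WHDTS.colimDesc (s : Cocone F) : WHDTS.colim F ⟶ s.pt :=
  have hS : ∀ j (x : (F.obj j).State),
      colimit.desc _ ((WHDTS.stateFunctor Lab).mapCocone s)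
        (colimit.ι (F ⋙ WHDTS.stateFunctor Lab) j x) = (s.ι.app j).onState x :=
    fun j x => ConcreteCategory.congr_hom
      (colimit.ι_desc ((WHDTS.stateFunctor Lab).mapCocone s) j) x
  have hA : ∀ j (x : (F.obj j).Action),
      colimit.desc _ ((WHDTS.actionFunctor Lab).mapCocone s)
        (colimit.ι (F ⋙ WHDTS.actionFunctor Lab) j x) = (s.ι.app j).onAction x :=
    fun j x => ConcreteCategory.congr_hom
      (colimit.ι_desc ((WHDTS.actionFunctor Lab).mapCocone s) j) x
  { onState := fun x => colimit.desc _ ((WHDTS.stateFunctor Lab).mapCocone s) x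
    onAction := fun x => colimit.desc _ ((WHDTS.actionFunctor Lab).mapCocone s) x
    label_eq := fun a => by
      obtain ⟨j, b, rfl⟩ := Types.jointly_surjective' a
      have h1 := ConcreteCategory.congr_hom (colimit.ι_desc (WHDTS.labelCocone F) j) b
      exact ((congrArg s.pt.label (hA j b)).trans ((s.ι.app j).label_eq b)).trans h1.symm
    map_trans := WHDTS.ColimTrans.desc F s.pt _ _ fun j α l β h => by
      have h' := (s.ι.app j).map_trans α l β h
      rw [← hS, ← hS, ← funext fun x => hA j x] at h'
      exact h' }

/-- The cocone is colimiting. -/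
noncomputable def WHDTS.colimIsColimit : IsColimit (WHDTS.colimCocone F) where
  desc s := WHDTS.colimDesc F s
  fac s j := WHDTS.Hom.ext
    (funext fun x => ConcreteCategory.congr_hom
      (colimit.ι_desc ((WHDTS.stateFunctor Lab).mapCocone s) j) x)
    (funext fun x => ConcreteCategory.congr_hom
      (colimit.ι_desc ((WHDTS.actionFunctor Lab).mapCocone s) j) x)
  uniq s m hm := WHDTS.Hom.ext
    (funext fun x => by
      obtain ⟨j, b, rfl⟩ := Types.jointly_surjective' x
      have h1 := ConcreteCategory.congr_hom
        (colimit.ι_desc ((WHDTS.stateFunctor Lab).mapCocone s) j) b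
      exact (congrFun (congrArg WHDTS.Hom.onState (hm j)) b).trans h1.symm)
    (funext fun x => by
      obtain ⟨j, b, rfl⟩ := Types.jointly_surjective' x
      have h1 := ConcreteCategory.congr_hom
        (colimit.ι_desc ((WHDTS.actionFunctor Lab).mapCocone s) j) b
      exact (congrFun (congrArg WHDTS.Hom.onAction (hm j)) b).trans h1.symm)

end Colimits

instance (Lab : Type u) : HasColimitsOfSize.{u, u} (WHDTS Lab) where
  has_colimits_of_shape _ _ := ⟨fun F => ⟨⟨⟨WHDTS.colimCocone F, WHDTS.colimIsColimit F⟩⟩⟩⟩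

instance (Lab : Type u) : HasColimitsOfSize.{0, u} (WHDTS Lab) :=
  hasColimitsOfSizeShrink.{0, u, u, u} (WHDTS Lab)

/-! ## Cubes, realization and cubification -/

/-- The labelled `n`-cube `Cₙ[a₁,…,aₙ]`; the action `(aᵢ, i)` is encoded by `i`. -/
def WHDTS.cube {Lab : Type u} {n : ℕ} (a : Fin n → Lab) : WHDTS Lab where
  State := ULift.{u} (Vertex n)
  Action := ULift.{u} (Fin n)
  label i := a i.down
  trans α l β := l ≠ [] ∧ l.Nodup ∧ α.down ≤ β.down ∧
    ∀ i, α.down i ≠ β.down i ↔ ULift.up i ∈ l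
  ne_nil h := h.1
  multiset hp h := ⟨fun h0 => h.1 (by subst h0; exact hp.eq_nil), hp.nodup_iff.1 h.2.1, h.2.2.1,
    fun i => (h.2.2.2 i).trans hp.mem_iff⟩
  coherence := by
    intro α β ν₁ ν₂ l₁ l₂ l₃ h₁ h₂ h₃ t t₁ t₂ t₃ t₄
    have key : ∀ i, ν₁.down i ≤ ν₂.down i ∧ (ν₁.down i ≠ ν₂.down i ↔ ULift.up i ∈ l₂) := by
      intro i
      have a1 := t₁.2.2.1 i
      have a2 := t₁.2.2.2 i
      have b1 := t₃.2.2.1 i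
      have b2 := t₃.2.2.2 i
      have c := t₃.2.1
      rw [List.nodup_append] at c
      have c3 := fun ha hb => c.2.2 (ULift.up i) ha (ULift.up i) hb rfl
      rw [List.mem_append] at b2
      revert a1 a2 b1 b2
      cases α.down i <;> cases ν₁.down i <;> cases ν₂.down i <;> simp <;> tauto
    exact ⟨h₂, t₂.2.1.sublist (List.sublist_append_left _ _), fun i => (key i).1,
      fun i => (key i).2⟩

/-- The realization of the labelled cubes: `□_S[a₁,…,aₙ] ↦ Cₙ[a₁,…,aₙ]`. A map
`f : [m] → [n]` acts by `f` on states and by `(aᵢ, i) ↦ (aᵢ, f.dir i)` on actions. -/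
noncomputable def cubeRealization (Lab : Type u) : LabCube Lab ⥤ WHDTS Lab where
  obj A := WHDTS.cube A.label
  map {A B} f :=
    { onState := fun s => ⟨f.box.toFun s.down⟩
      onAction := fun i => ⟨f.box.dir i.down⟩
      label_eq := fun i => f.label_eq i.down
      map_trans := by
        rintro ⟨α⟩ l ⟨β⟩ ⟨h1, h2, h3, h4⟩
        refine ⟨map_ne_nil _ h1, h2.map ?_, f.box.strictMono.monotone h3, fun j => ?_⟩
        · rintro ⟨i⟩ ⟨k⟩ h
          exact congrArg ULift.up (f.box.dir_injective (ULift.up_injective h))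
        · change f.box.toFun α j ≠ f.box.toFun β j ↔ _
          by_cases hj : ∃ i, f.box.dir i = j
          · obtain ⟨i, rfl⟩ := hj
            rw [f.box.apply_dir, f.box.apply_dir]
            refine (h4 i).trans ⟨fun h => List.mem_map.2 ⟨_, h, rfl⟩, fun h => ?_⟩
            obtain ⟨⟨k⟩, hk, e⟩ := List.mem_map.1 h
            have := f.box.dir_injective (ULift.up_injective e)
            exact this ▸ hk
          · push Not at hj
            rw [f.box.apply_of_notMem α j hj, f.box.apply_of_notMem β j hj]
            refine ⟨fun h => absurd rfl h, fun h => ?_⟩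
            obtain ⟨⟨k⟩, hk, e⟩ := List.mem_map.1 h
            exact absurd (ULift.up_injective e) (hj k) }
  map_id A := WHDTS.Hom.ext rfl (funext fun i => congrArg ULift.up (BoxHom.dir_id i.down))
  map_comp f g := WHDTS.Hom.ext rfl
    (funext fun i => congrArg ULift.up (BoxHom.dir_comp f.box g.box i.down))

/-- The realization `𝕋(K) = colim_{□_S[a₁,…,aₙ] ⟶ K} Cₙ[a₁,…,aₙ]` of labelled symmetric
precubical sets as weak higher dimensional transition systems, the colimit being taken in `WHDTS`:
the colimit-preserving extension of the realization of the labelled cubes. -/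
noncomputable def realization (Lab : Type u) : LabSymPrecubicalSet Lab ⥤ WHDTS Lab :=
  (labCubeFunctor Lab).pointwiseLeftKanExtension (cubeRealization Lab)

/-- The full subcategory of `WHDTS` whose objects are the labelled cubes. -/
abbrev WHDTSCube (Lab : Type u) :=
  InducedCategory (WHDTS Lab) (fun A : (Σ n : ℕ, Fin n → Lab) => WHDTS.cube A.2)

/-- Its inclusion functor. -/
abbrev whdtsCubeInclusion (Lab : Type u) : WHDTSCube Lab ⥤ WHDTS Lab :=
  inducedFunctor (fun A : (Σ n : ℕ, Fin n → Lab) => WHDTS.cube A.2)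

/-- The cubification functor `cub(X) = colim_{Cₙ[a₁,…,aₙ] ⟶ X} Cₙ[a₁,…,aₙ]`, the colimit
being taken in `WHDTS`. -/
noncomputable def cub (Lab : Type u) : WHDTS Lab ⥤ WHDTS Lab :=
  (whdtsCubeInclusion Lab).pointwiseLeftKanExtension (whdtsCubeInclusion Lab)

/-- The maps `f` of higher dimensional transition systems such that `cub(f)` is an isomorphism. -/
def cubIso (Lab : Type u) : MorphismProperty (HDTS Lab) :=
  (MorphismProperty.isomorphisms (WHDTS Lab)).inverseImage ((isHDTS Lab).ι ⋙ cub Lab)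

/-- The labelled symmetric precubical sets `K` which satisfy the paradigm of higher dimensional
automata, which have at most one `1`-cube with given endpoints and given label, and whose
realization `𝕋(K)` is a higher dimensional transition system. -/
def isHDAhdts (Lab : Type u) : ObjectProperty (LabSymPrecubicalSet Lab) :=
  fun K => HDAParadigm K ∧ AtMostOneFiller 1 K ∧ isHDTS Lab ((realization Lab).obj K)

/-- The realization functor restricted to `HDA_hdts`. -/
noncomputable def realizationHDTS (Lab : Type u) : (isHDAhdts Lab).FullSubcategory ⥤ HDTS Lab :=
  (isHDTS Lab).lift ((isHDAhdts Lab).ι ⋙ realization Lab) fun K => K.property.2.2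

/-! ## Comparison of higher dimensional transition systems -/

/-- `X` and `Y` have the same cubes, up to their actions: there is a bijection between the sets of
states such that a labelled `n`-tuple of directions and a family of states indexed by `{0,1}ⁿ`
underlie an `n`-cube of `X` if and only if they underlie an `n`-cube of `Y`. -/
def WHDTS.SameCubes {Lab : Type u} (X Y : WHDTS Lab) : Prop :=
  ∃ φ : X.State ≃ Y.State, ∀ (n : ℕ) (a : Fin n → Lab) (g : Vertex n → X.State),
    (∃ c : WHDTS.cube a ⟶ X, ∀ ε, c.onState ⟨ε⟩ = g ε) ↔
      ∃ c : WHDTS.cube a ⟶ Y, ∀ ε, c.onState ⟨ε⟩ = φ (g ε)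

/-- An action `u` is used if there is a transition `(α, u, β)`. -/
def WHDTS.Used {Lab : Type u} (X : WHDTS Lab) (u : X.Action) : Prop :=
  ∃ α β, X.trans α [u] β

/-- The restriction of `X` to its used actions. -/
def WHDTS.usedPart {Lab : Type u} (X : WHDTS Lab) : WHDTS Lab where
  State := X.State
  Action := {u : X.Action // X.Used u}
  label u := X.label u.1
  trans α l β := X.trans α (l.map Subtype.val) β
  ne_nil h := fun h0 => X.ne_nil h (by rw [h0]; rfl)
  multiset hp h := X.multiset (hp.map _) h
  coherence h₁ h₂ h₃ t t₁ t₂ t₃ t₄ := by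
    rw [List.map_append, List.map_append] at t
    rw [List.map_append] at t₂ t₃
    exact X.coherence (map_ne_nil _ h₁) (map_ne_nil _ h₂) (map_ne_nil _ h₃) t t₁ t₂ t₃ t₄

end HDA

/-! The realization is left adjoint to the nerve, which sends a system to the labelled symmetric
precubical set of its cubes. The theorem follows from the behaviour of this adjunction on higher
dimensional transition systems.

The difficulty is that a colimit of systems may acquire new transitions through the Coherence axiom.
The remedy is to isolate the uniqueness half of CSA2, `WHDTS.UniqueIntermediate`. Under this
condition Coherence adds nothing to the transitions of a family of cubes
(`WHDTS.FromCubes.coherence`): the longest transition lies in one cube, and uniqueness forces the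
two given intermediate states to be vertices of that cube. Hence every transition comes from a cube,
which yields CSA2 and CSA3, and every positive-dimensional cube of the system is a face of a given
one. Together with the fact that cells are determined by labels and vertices, this also yields CSA1.
So membership in `isHDAhdts` reduces to two uniqueness conditions (`isHDAhdts_iff`).

For (1), nerves of HDTS satisfy these conditions, and the unit is invertible on `isHDAhdts`
(`isIso_realUnit`). The restricted nerve thus has a fully faithful left adjoint and is a
localization at the maps it inverts. These are the maps inverted by `cub`, because `cub X` and `X`
have the same cubes when intermediate states are unique.

For (2), uniqueness conditions can be tested on any jointly injective family of maps, so identifying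
the cells that no map to `isHDAhdts` separates gives a reflection. They also involve finitely many
cells, states and transitions at a time, so they pass to filtered colimits; the labelled cubes are
finitely presentable strong generators.

For (3) and (4), objects are isomorphic in the localization exactly when their nerves are, and CSA1
recovers a cube from its vertices and labels. Cubes never use an unused action. -/

namespace HDA

/-! ## Transitions and faces of cubes -/

/-- The transitions of the `n`-cube. -/
def CubeTrans {n : ℕ} (α : Vertex n) (l : List (Fin n)) (β : Vertex n) : Prop :=
  l ≠ [] ∧ l.Nodup ∧ α ≤ β ∧ ∀ i, α i ≠ β i ↔ i ∈ l

namespace CubeTrans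

variable {n : ℕ} {α β γ : Vertex n} {l l₁ l₂ l₃ : List (Fin n)}

/-- The intermediate vertex is `α` with the coordinates listed in `l₁` raised to `1`. -/
theorem exists_split (h : CubeTrans α (l₁ ++ l₂) β) (h₁ : l₁ ≠ []) (h₂ : l₂ ≠ []) :
    ∃ γ, CubeTrans α l₁ γ ∧ CubeTrans γ l₂ β := by
  obtain ⟨-, hn, hle, h⟩ := h
  rw [List.nodup_append] at hn
  refine ⟨fun i => if i ∈ l₁ then true else α i, ⟨h₁, hn.1, fun i => ?_, fun i => ?_⟩,
    ⟨h₂, hn.2.1, fun i => ?_, fun i => ?_⟩⟩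
  all_goals
    have a1 := hle i
    have a2 := h i
    have a3 := fun ha hb => hn.2.2 i ha i hb rfl
    rw [List.mem_append] at a2
    by_cases hi : i ∈ l₁ <;> by_cases hj : i ∈ l₂ <;> simp only [hi, hj, if_true, if_false] at * <;>
      revert a1 a2 <;> cases α i <;> cases β i <;> simp_all

theorem append (h : CubeTrans α l₁ γ) (h' : CubeTrans γ l₂ β) (hn : (l₁ ++ l₂).Nodup) :
    CubeTrans α (l₁ ++ l₂) β := by
  refine ⟨by simp [h.1], hn, h.2.2.1.trans h'.2.2.1, fun i => ?_⟩
  have a1 := h.2.2.1 i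
  have a2 := h'.2.2.1 i
  have a3 := h.2.2.2 i
  have a4 := h'.2.2.2 i
  rw [List.mem_append, ← a3, ← a4]
  revert a1 a2
  cases α i <;> cases β i <;> cases γ i <;> simp

theorem perm (h : CubeTrans α l₁ β) (hp : l₁.Perm l₂) : CubeTrans α l₂ β :=
  ⟨fun h0 => h.1 (by subst h0; exact hp.eq_nil), hp.nodup_iff.1 h.2.1, h.2.2.1,
    fun i => (h.2.2.2 i).trans hp.mem_iff⟩

/-- The intermediate vertices of a transition which is cut into three pieces. -/
theorem exists_split₃ (h : CubeTrans α (l₁ ++ l₂ ++ l₃) β) (h₁ : l₁ ≠ []) (h₂ : l₂ ≠ [])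
    (h₃ : l₃ ≠ []) : ∃ γ δ, CubeTrans α l₁ γ ∧ CubeTrans γ l₂ δ ∧ CubeTrans δ l₃ β ∧
      CubeTrans α (l₁ ++ l₂) δ ∧ CubeTrans γ (l₂ ++ l₃) β := by
  obtain ⟨δ, ha, hb⟩ := h.exists_split (by simp [h₁]) h₃
  obtain ⟨γ, hc, hd⟩ := ha.exists_split h₁ h₂
  refine ⟨γ, δ, hc, hd, hb, ha, hd.append hb (h.2.1.sublist ?_)⟩
  rw [List.append_assoc]
  exact List.sublist_append_right _ _

theorem bot_top (hl : l ≠ []) (hn : l.Nodup) (hm : ∀ i, i ∈ l) :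
    CubeTrans (fun _ => false) l (fun _ => true) :=
  ⟨hl, hn, fun _ => Bool.false_le _, fun i => by simp [hm i]⟩

end CubeTrans

namespace BoxHom

variable {m n : ℕ} (d : Fin m → Fin n) (α : Vertex n)

open Classical in
/-- The map of vertices with directions `d` whose other coordinates are those of `α`. -/
noncomputable def faceFun (ε : Vertex m) : Vertex n := fun j =>
  if h : ∃ i, d i = j then ε h.choose else α j

variable {d}

theorem faceFun_dir (hd : Function.Injective d) (ε : Vertex m) (i : Fin m) :
    faceFun d α ε (d i) = ε i := by
  have h : ∃ k, d k = d i := ⟨i, rfl⟩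
  rw [faceFun, dif_pos h, hd h.choose_spec]

theorem faceFun_of_notMem (ε : Vertex m) (j : Fin n) (hj : ∀ i, d i ≠ j) :
    faceFun d α ε j = α j := by
  rw [faceFun, dif_neg (by push Not; exact hj)]

/-- The face with (injective) directions `d` whose other coordinates are those of `α`. -/
noncomputable def face (hd : Function.Injective d) : BoxHom m n where
  toFun := faceFun d α
  strictMono := by
    intro x y h
    rw [Pi.lt_def] at h ⊢
    obtain ⟨hle, i, hi⟩ := h
    refine ⟨fun j => ?_, d i, by rwa [faceFun_dir α hd, faceFun_dir α hd]⟩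
    by_cases hj : ∃ k, d k = j
    · obtain ⟨k, rfl⟩ := hj
      rw [faceFun_dir α hd, faceFun_dir α hd]
      exact hle k
    · push Not at hj
      rw [faceFun_of_notMem α x j hj, faceFun_of_notMem α y j hj]
  adjacency := by
    intro x y h
    rw [hammingDist] at h ⊢
    rw [← h, ← Finset.card_image_of_injective _ hd]
    congr 1
    ext j
    by_cases hj : ∃ k, d k = j
    · obtain ⟨k, rfl⟩ := hj
      simp [faceFun_dir α hd, hd.eq_iff]
    · push Not at hj
      simp [faceFun_of_notMem α _ j hj, hj]
  injective := by
    intro x y h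
    ext i
    have := congrFun h (d i)
    rwa [faceFun_dir α hd, faceFun_dir α hd] at this

theorem face_apply_dir (hd : Function.Injective d) (ε : Vertex m) (i : Fin m) :
    (face α hd).toFun ε (d i) = ε i := faceFun_dir α hd ε i

theorem face_apply_of_notMem (hd : Function.Injective d) (ε : Vertex m) (j : Fin n)
    (hj : ∀ i, d i ≠ j) : (face α hd).toFun ε j = α j := faceFun_of_notMem α ε j hj

theorem face_dir (hd : Function.Injective d) (i : Fin m) : (face α hd).dir i = d i := by
  refine dir_eq _ _ _ (fun _ => false) rfl ⟨face_apply_dir α hd _ i, ?_⟩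
  ext j
  by_cases hj : ∃ k, d k = j
  · obtain ⟨k, rfl⟩ := hj
    simp [face_apply_dir α hd, Function.update_apply, hd.eq_iff]
  · push Not at hj
    rw [Function.update_of_ne (hj i).symm, face_apply_of_notMem α hd _ j hj,
      face_apply_of_notMem α hd _ j hj]

/-- Every transition of a cube is the total transition of a face. -/
theorem exists_face {α β : Vertex n} {d : Fin m → Fin n} (h : CubeTrans α (List.ofFn d) β) :
    ∃ f : BoxHom m n, f.dir = d ∧ f.toFun (fun _ => false) = α ∧ f.toFun (fun _ => true) = β := by
  have hd := List.nodup_ofFn.1 h.2.1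
  refine ⟨face α hd, funext (face_dir α hd), funext fun j => ?_, funext fun j => ?_⟩
  all_goals
    have a1 := h.2.2.1 j
    have a2 := h.2.2.2 j
    rw [List.mem_ofFn] at a2
    by_cases hj : ∃ k, d k = j
    · obtain ⟨k, rfl⟩ := hj
      rw [face_apply_dir]
      revert a1 a2
      cases α (d k) <;> cases β (d k) <;> simp
    · refine (face_apply_of_notMem α hd _ j (by push Not at hj; exact hj)).trans ?_
      revert a1 a2
      cases α j <;> cases β j <;> simp_all

/-- The vertices of the `n`-cube, as maps `[0] → [n]`. -/
def vertex (ε : Vertex n) : BoxHom 0 n where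
  toFun _ := ε
  strictMono _ _ h := absurd (Subsingleton.elim _ _) h.ne
  adjacency x y h := by simp [Subsingleton.elim x y] at h
  injective _ _ _ := Subsingleton.elim _ _

end BoxHom

/-! ## Cubes of weak higher dimensional transition systems -/

/-- The `n`-cubes of `X`: the maps from the `n`-cube, the labels of the latter being those of the
images of its actions. -/
@[ext]
structure CubeIn {Lab : Type u} (X : WHDTS Lab) (n : ℕ) where
  vert : Vertex n → X.State
  act : Fin n → X.Action
  map_trans : ∀ α l β, CubeTrans α l β → X.trans (vert α) (l.map act) (vert β)

namespace CubeIn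

variable {Lab : Type u} {X Y Z : WHDTS Lab} {m n p : ℕ}

theorem cubeTrans_of_trans {a : Fin n → Lab} {α l β} (t : (WHDTS.cube a).trans α l β) :
    CubeTrans α.down (l.map ULift.down) β.down :=
  ⟨map_ne_nil _ t.1, t.2.1.map ULift.down_injective, t.2.2.1, fun i => (t.2.2.2 i).trans
    ⟨fun h => List.mem_map.2 ⟨_, h, rfl⟩, fun h => by
      obtain ⟨j, hj, rfl⟩ := List.mem_map.1 h
      exact hj⟩⟩

/-- The cube underlying a map from a labelled cube. -/
def ofHom {a : Fin n → Lab} (c : WHDTS.cube a ⟶ X) : CubeIn X n where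
  vert ε := c.onState ⟨ε⟩
  act i := c.onAction ⟨i⟩
  map_trans α l β h := by
    have := c.map_trans ⟨α⟩ (l.map ULift.up) ⟨β⟩ ⟨map_ne_nil _ h.1, h.2.1.map ULift.up_injective,
      h.2.2.1, fun i => (h.2.2.2 i).trans (List.mem_map_of_injective ULift.up_injective).symm⟩
    exact (congrArg (fun w => X.trans _ w _) List.map_map).mp this

/-- The map from a labelled cube which corresponds to a cube with the same labels. -/
def toHom (x : CubeIn X n) {a : Fin n → Lab} (h : ∀ i, X.label (x.act i) = a i) :
    WHDTS.cube a ⟶ X where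
  onState s := x.vert s.down
  onAction i := x.act i.down
  label_eq i := h i.down
  map_trans α l β t := by
    have := x.map_trans _ _ _ (cubeTrans_of_trans t)
    exact (congrArg (fun w => X.trans _ w _) List.map_map).mp this

theorem ofHom_injective {a : Fin n → Lab} {c c' : WHDTS.cube a ⟶ X} (h : ofHom c = ofHom c') :
    c = c' :=
  WHDTS.Hom.ext (funext fun s => congrFun (congrArg vert h) s.down)
    (funext fun i => congrFun (congrArg act h) i.down)

theorem label_ofHom {a : Fin n → Lab} (c : WHDTS.cube a ⟶ X) (i : Fin n) :
    X.label ((ofHom c).act i) = a i := c.label_eq ⟨i⟩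

/-- The image of a cube. -/
def map (g : X ⟶ Y) (x : CubeIn X n) : CubeIn Y n where
  vert ε := g.onState (x.vert ε)
  act i := g.onAction (x.act i)
  map_trans α l β h := by
    have := g.map_trans _ _ _ (x.map_trans α l β h)
    rwa [List.map_map] at this

/-- The faces of a cube. -/
noncomputable def res (f : BoxHom m n) (x : CubeIn X n) : CubeIn X m where
  vert ε := x.vert (f.toFun ε)
  act i := x.act (f.dir i)
  -- Transitions of the face are those of the composite of the cube map induced by `f` with the map
  -- classifying `x`.
  map_trans := (ofHom ((cubeRealization Lab).map (X := ⟨m, fun i => X.label (x.act (f.dir i))⟩)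
    (Y := ⟨n, fun i => X.label (x.act i)⟩) ⟨f, fun _ => rfl⟩ ≫ x.toHom fun _ => rfl)).map_trans

theorem res_id (x : CubeIn X n) : x.res (BoxHom.id n) = x :=
  CubeIn.ext rfl (funext fun i => congrArg x.act (BoxHom.dir_id i))

theorem res_comp (f : BoxHom m n) (g : BoxHom n p) (x : CubeIn X p) :
    x.res (f.comp g) = (x.res g).res f :=
  CubeIn.ext rfl (funext fun i => congrArg x.act (BoxHom.dir_comp f g i))

theorem edge (x : CubeIn X n) (i : Fin n) :
    X.trans (x.vert fun _ => false) [x.act i] (x.vert fun j => decide (j = i)) :=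
  x.map_trans _ [i] _ ⟨by simp, by simp, fun _ => Bool.false_le _, fun j => by simp⟩

end CubeIn

/-! ### Unique intermediate states, and transitions that come from cubes. -/

namespace WHDTS

variable {Lab : Type u}

/-- The uniqueness part of the second Cattani-Sassone axiom. -/
def UniqueIntermediate (X : WHDTS Lab) : Prop :=
  ∀ ⦃α l₁ l₂ β ν ν'⦄, l₁ ≠ [] → l₂ ≠ [] → X.trans α (l₁ ++ l₂) β →
    X.trans α l₁ ν → X.trans ν l₂ β → X.trans α l₁ ν' → X.trans ν' l₂ β → ν = ν'

theorem CSA2.uniqueIntermediate {X : WHDTS Lab} (h : X.CSA2) : X.UniqueIntermediate :=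
  fun _ _ _ _ _ _ h₁ h₂ t a b a' b' => (h _ _ _ _ h₁ h₂ t).1.unique ⟨a, b⟩ ⟨a', b'⟩

/-- The hypotheses are only pushed forward, so injectivity on states suffices and nothing is asked
of `f` on actions. This is what makes the condition pass to `cub X` and to the realization of a
nerve, along their counits. -/
theorem UniqueIntermediate.of_hom {X Y : WHDTS Lab} (hY : Y.UniqueIntermediate) (f : X ⟶ Y)
    (hf : Function.Injective f.onState) : X.UniqueIntermediate := by
  intro α l₁ l₂ β ν ν' h₁ h₂ t a b a' b'
  have t' := f.map_trans _ _ _ t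
  rw [List.map_append] at t'
  exact hf (hY (map_ne_nil _ h₁) (map_ne_nil _ h₂) t' (f.map_trans _ _ _ a)
    (f.map_trans _ _ _ b) (f.map_trans _ _ _ a') (f.map_trans _ _ _ b'))

/-- Cubes of a system with unique intermediate states are determined by their initial and final
states and their actions. -/
theorem UniqueIntermediate.cube_ext {X : WHDTS Lab} (hX : X.UniqueIntermediate) {n : ℕ}
    {x y : CubeIn X n} (h0 : x.vert (fun _ => false) = y.vert fun _ => false)
    (h1 : x.vert (fun _ => true) = y.vert fun _ => true) (ha : x.act = y.act) : x = y := by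
  refine CubeIn.ext (funext fun ε => ?_) ha
  -- The vertex `ε` is an intermediate state of the total transition of the cube, cut into the
  -- directions where `ε` is `1` and those where it is `0`. The two extreme vertices are treated
  -- apart because a transition has at least one action.
  set l₁ := (List.finRange n).filter fun i => ε i = true with hl₁
  set l₂ := (List.finRange n).filter fun i => ¬ ε i = true with hl₂
  by_cases e1 : l₁ = []
  · have : ε = fun _ => false := by
      funext i
      have : i ∉ l₁ := by simp [e1]
      simpa [hl₁] using this
    rw [this, h0]
  by_cases e2 : l₂ = []
  · have : ε = fun _ => true := by
      funext i
      have : i ∉ l₂ := by simp [e2]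
      simpa [hl₂] using this
    rw [this, h1]
  have t1 : CubeTrans (fun _ => false) l₁ ε :=
    ⟨e1, (List.nodup_finRange n).filter _, fun _ => Bool.false_le _, fun i => by simp [hl₁]⟩
  have t2 : CubeTrans ε l₂ (fun _ => true) :=
    ⟨e2, (List.nodup_finRange n).filter _, fun _ => Bool.le_true _, fun i => by simp [hl₂]⟩
  have t := t1.append t2 (by
    refine List.nodup_append.2 ⟨t1.2.1, t2.2.1, ?_⟩
    rintro a ha _ hb rfl
    simp [hl₁] at ha
    simp [hl₂, ha] at hb)
  have t' := x.map_trans _ _ _ t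
  have a1 := x.map_trans _ _ _ t1
  have a2 := x.map_trans _ _ _ t2
  have b1 := y.map_trans _ _ _ t1
  have b2 := y.map_trans _ _ _ t2
  rw [List.map_append] at t'
  rw [← h0, ← ha] at b1
  rw [← h1, ← ha] at b2
  exact hX (map_ne_nil _ e1) (map_ne_nil _ e2) t' a1 a2 b1 b2

/-- The transitions which come from a family of cubes. -/
def FromCubes {Z : WHDTS Lab} (C : ∀ n, Set (CubeIn Z n)) (α : Z.State) (l : List Z.Action)
    (β : Z.State) : Prop :=
  ∃ n, ∃ x ∈ C n, ∃ α' l' β', CubeTrans α' l' β' ∧ x.vert α' = α ∧ l'.map x.act = l ∧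
    x.vert β' = β

variable {Z : WHDTS Lab} {C : ∀ n, Set (CubeIn Z n)}

theorem FromCubes.trans {α l β} (h : FromCubes C α l β) : Z.trans α l β := by
  obtain ⟨n, x, -, α, l, β, h, rfl, rfl, rfl⟩ := h
  exact x.map_trans _ _ _ h

/-- A permutation of the image of a list of directions lifts to a permutation of the directions
themselves, even when `x.act` is not injective. -/
theorem FromCubes.multiset {α l l' β} (hp : l.Perm l') (h : FromCubes C α l β) :
    FromCubes C α l' β := by
  obtain ⟨n, x, hx, α, k, β, h, rfl, rfl, rfl⟩ := h
  have hp' := congrFun (congrFun (List.eq_map_comp_perm x.act) l') k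
  obtain ⟨k', e, hk⟩ := hp'.mpr hp.symm
  exact ⟨n, x, hx, α, k', β, h.perm hk.symm, rfl, e.symm, rfl⟩

theorem FromCubes.exists_split {α l₁ l₂ β} (h : FromCubes C α (l₁ ++ l₂) β) (h₁ : l₁ ≠ [])
    (h₂ : l₂ ≠ []) : ∃ ν, FromCubes C α l₁ ν ∧ FromCubes C ν l₂ β := by
  obtain ⟨n, x, hx, α, k, β, h, rfl, e, rfl⟩ := h
  obtain ⟨k₁, k₂, rfl, rfl, rfl⟩ := List.map_eq_append_iff.1 e
  obtain ⟨γ, a, b⟩ := h.exists_split (fun h => h₁ (by simp [h])) (fun h => h₂ (by simp [h]))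
  exact ⟨x.vert γ, ⟨n, x, hx, _, _, _, a, rfl, rfl, rfl⟩, ⟨n, x, hx, _, _, _, b, rfl, rfl, rfl⟩⟩

theorem FromCubes.exists_split₃ {α l₁ l₂ l₃ β} (h : FromCubes C α (l₁ ++ l₂ ++ l₃) β)
    (h₁ : l₁ ≠ []) (h₂ : l₂ ≠ []) (h₃ : l₃ ≠ []) :
    ∃ ν₁ ν₂, FromCubes C α l₁ ν₁ ∧ FromCubes C ν₁ l₂ ν₂ ∧ FromCubes C ν₂ l₃ β ∧
      FromCubes C α (l₁ ++ l₂) ν₂ ∧ FromCubes C ν₁ (l₂ ++ l₃) β := by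
  obtain ⟨n, x, hx, α, k, β, h, rfl, e, rfl⟩ := h
  obtain ⟨k', k₃, rfl, e', rfl⟩ := List.map_eq_append_iff.1 e
  obtain ⟨k₁, k₂, rfl, rfl, rfl⟩ := List.map_eq_append_iff.1 e'
  obtain ⟨γ, δ, a, b, c, d, e⟩ := h.exists_split₃ (fun h => h₁ (by simp [h]))
    (fun h => h₂ (by simp [h])) (fun h => h₃ (by simp [h]))
  exact ⟨x.vert γ, x.vert δ, ⟨n, x, hx, _, _, _, a, rfl, rfl, rfl⟩,
    ⟨n, x, hx, _, _, _, b, rfl, rfl, rfl⟩, ⟨n, x, hx, _, _, _, c, rfl, rfl, rfl⟩,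
    ⟨n, x, hx, _, _, _, d, rfl, List.map_append, rfl⟩,
    ⟨n, x, hx, _, _, _, e, rfl, List.map_append, rfl⟩⟩

/-- Under uniqueness of the intermediate states, the Coherence axiom adds no new transitions to
those which come from cubes. -/
theorem FromCubes.coherence (hZ : Z.UniqueIntermediate) {α β ν₁ ν₂ l₁ l₂ l₃} (h₁ : l₁ ≠ [])
    (h₂ : l₂ ≠ []) (h₃ : l₃ ≠ []) (t : FromCubes C α (l₁ ++ l₂ ++ l₃) β)
    (t₁ : FromCubes C α l₁ ν₁) (t₂ : FromCubes C ν₁ (l₂ ++ l₃) β)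
    (t₃ : FromCubes C α (l₁ ++ l₂) ν₂) (t₄ : FromCubes C ν₂ l₃ β) : FromCubes C ν₁ l₂ ν₂ := by
  -- Both intermediate states are taken in the single cube carrying `t`, where the transition
  -- between them is available.
  obtain ⟨μ₁, μ₂, a, b, c, d, e⟩ := t.exists_split₃ h₁ h₂ h₃
  obtain rfl : ν₁ = μ₁ := hZ h₁ (by simp [h₂]) (by simpa using t.trans) t₁.trans t₂.trans
    a.trans e.trans
  obtain rfl : ν₂ = μ₂ := hZ (by simp [h₁]) h₃ t.trans t₃.trans t₄.trans d.trans c.trans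
  exact b

/-- A system whose transitions come from cubes satisfies CSA2 if intermediate states are unique. -/
theorem UniqueIntermediate.csa2 (hZ : Z.UniqueIntermediate)
    (hC : ∀ α l β, Z.trans α l β → FromCubes C α l β) : Z.CSA2 := by
  have key : ∀ α β l₁ l₂, l₁ ≠ [] → l₂ ≠ [] → Z.trans α (l₁ ++ l₂) β →
      ∃! ν₁, Z.trans α l₁ ν₁ ∧ Z.trans ν₁ l₂ β := by
    intro α β l₁ l₂ h₁ h₂ t
    obtain ⟨ν, a, b⟩ := (hC _ _ _ t).exists_split h₁ h₂
    exact ⟨ν, ⟨a.trans, b.trans⟩, fun ν' h => hZ h₁ h₂ t h.1 h.2 a.trans b.trans⟩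
  exact fun α β l₁ l₂ h₁ h₂ t =>
    ⟨key α β l₁ l₂ h₁ h₂ t, key α β l₂ l₁ h₂ h₁ (Z.multiset List.perm_append_comm t)⟩

/-- A system whose transitions come from cubes satisfies CSA3 if intermediate states are unique. -/
theorem UniqueIntermediate.csa3 (hZ : Z.UniqueIntermediate)
    (hC : ∀ α l β, Z.trans α l β → FromCubes C α l β) : Z.CSA3 := by
  intro α β ν₁ ν₂ ν₁' ν₂' l₁ l₂ l₃ h₁ h₂ h₃ t t₁ t₂ t₃ t₄ t₅ t₆ t₇ t₈
  obtain ⟨μ₁, μ₂, a, b, c, d, e⟩ := (hC _ _ _ t).exists_split₃ h₁ h₂ h₃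
  obtain rfl : ν₁ = μ₁ := hZ h₁ (by simp [h₂]) (by simpa using t) t₁ t₂ a.trans e.trans
  obtain rfl : ν₂' = μ₂ := hZ (by simp [h₁]) h₃ t t₅ t₆ d.trans c.trans
  exact ⟨hZ h₁ h₂ t₅ a.trans b.trans t₇ t₈, hZ h₂ h₃ t₂ t₃ t₄ b.trans c.trans⟩

/-- If all transitions come from a family of cubes which is stable under faces, then all cubes of
positive dimension belong to the family. -/
theorem UniqueIntermediate.mem_of_fromCubes (hZ : Z.UniqueIntermediate)
    (hC : ∀ α l β, Z.trans α l β → FromCubes C α l β)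
    (hres : ∀ m n (f : BoxHom m n), ∀ x ∈ C n, x.res f ∈ C m) {n : ℕ} (hn : n ≠ 0)
    (c : CubeIn Z n) : c ∈ C n := by
  -- The total transition of `c` lies in a cube `x` of the family. It is the total transition of a
  -- face of `x`, and that face shares its end states and actions with `c`. Dimension `0` is
  -- excluded because a point has no transition.
  have t := c.map_trans _ _ _ (CubeTrans.bot_top (l := List.finRange n)
    (by simpa using hn) (List.nodup_finRange n) List.mem_finRange)
  obtain ⟨m, x, hx, α, l, β, h, e0, el, e1⟩ := hC _ _ _ t
  obtain rfl : l.length = n := by simpa using congrArg List.length el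
  obtain ⟨f, fd, f0, f1⟩ := BoxHom.exists_face (d := l.get) (by rwa [List.ofFn_get])
  have : c = x.res f := by
    refine hZ.cube_ext ?_ ?_ (funext fun i => ?_)
    · exact e0.symm.trans (congrArg x.vert f0.symm)
    · exact e1.symm.trans (congrArg x.vert f1.symm)
    · have h1 := List.getElem_of_eq el (i := i) (by simp)
      simp only [List.getElem_map, List.getElem_finRange] at h1
      refine Eq.trans ?_ (h1.symm.trans (congrArg x.act ?_))
      · rfl
      · rw [fd]; rfl
  rw [this]
  exact hres _ _ f x hx

/-- In a system satisfying CSA1, cubes are determined by their states and their labels. -/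
theorem CSA1.cube_ext {X : WHDTS Lab} (hX : X.CSA1) {n : ℕ} {x y : CubeIn X n}
    (hv : x.vert = y.vert) (hl : ∀ i, X.label (x.act i) = X.label (y.act i)) : x = y :=
  CubeIn.ext hv (funext fun i => hX _ _ _ _ (x.edge i) (by rw [hv]; exact y.edge i) (hl i))

/-- A property of the states, the actions and the transitions of a colimit holds if it holds for
those of the components and if it is stable under the Multiset and Coherence axioms. -/
theorem colimit_induction {J : Type*} [Category* J] {F : J ⥤ WHDTS Lab} {c : Cocone F}
    (hc : IsColimit c) (PS : c.pt.State → Prop) (PA : c.pt.Action → Prop)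
    (PT : c.pt.State → List c.pt.Action → c.pt.State → Prop)
    (hS : ∀ j s, PS ((c.ι.app j).onState s)) (hA : ∀ j a, PA ((c.ι.app j).onAction a))
    (hT : ∀ j α l β, (F.obj j).trans α l β → PT ((c.ι.app j).onState α)
      (l.map (c.ι.app j).onAction) ((c.ι.app j).onState β))
    (hm : ∀ α l l' β, l.Perm l' → PT α l β → PT α l' β)
    (hcoh : ∀ α β ν₁ ν₂ l₁ l₂ l₃, l₁ ≠ [] → l₂ ≠ [] → l₃ ≠ [] → PT α (l₁ ++ l₂ ++ l₃) β →
      PT α l₁ ν₁ → PT ν₁ (l₂ ++ l₃) β → PT α (l₁ ++ l₂) ν₂ → PT ν₂ l₃ β → PT ν₁ l₂ ν₂) :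
    (∀ s, PS s) ∧ (∀ a, PA a) ∧ ∀ α l β, c.pt.trans α l β → PT α l β := by
  -- The states, actions and transitions with the property form a subsystem through which the
  -- colimit cocone factors. The induced map followed by the inclusion is the identity, so the
  -- subsystem is everything.
  let X : WHDTS Lab :=
    { State := {s // PS s}
      Action := {a // PA a}
      label := fun a => c.pt.label a.1
      trans := fun α l β => c.pt.trans α.1 (l.map Subtype.val) β.1 ∧
        PT α.1 (l.map Subtype.val) β.1
      ne_nil := fun h h0 => c.pt.ne_nil h.1 (by rw [h0]; rfl)
      multiset := fun hp h => ⟨c.pt.multiset (hp.map _) h.1, hm _ _ _ _ (hp.map _) h.2⟩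
      coherence := by
        intro α β ν₁ ν₂ l₁ l₂ l₃ h₁ h₂ h₃ t t₁ t₂ t₃ t₄
        rw [List.map_append, List.map_append] at t
        rw [List.map_append] at t₂ t₃
        exact ⟨c.pt.coherence (map_ne_nil _ h₁) (map_ne_nil _ h₂) (map_ne_nil _ h₃) t.1 t₁.1
          t₂.1 t₃.1 t₄.1, hcoh _ _ _ _ _ _ _ (map_ne_nil _ h₁) (map_ne_nil _ h₂)
          (map_ne_nil _ h₃) t.2 t₁.2 t₂.2 t₃.2 t₄.2⟩ }
  let i : X ⟶ c.pt :=
    { onState := Subtype.val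
      onAction := Subtype.val
      label_eq := fun _ => rfl
      map_trans := fun _ _ _ h => h.1 }
  let s : Cocone F :=
    { pt := X
      ι :=
        { app := fun j =>
            { onState := fun x => ⟨_, hS j x⟩
              onAction := fun a => ⟨_, hA j a⟩
              label_eq := fun a => (c.ι.app j).label_eq a
              map_trans := fun α l β h => by
                have e : (l.map fun a => (⟨_, hA j a⟩ : {a // PA a})).map Subtype.val =
                    l.map (c.ι.app j).onAction := List.map_map
                refine ⟨?_, ?_⟩
                · exact e ▸ (c.ι.app j).map_trans _ _ _ h
                · exact e ▸ hT j _ _ _ h }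
          naturality := fun j k f => by
            have := c.ι.naturality f
            exact WHDTS.Hom.ext
              (funext fun x => Subtype.ext (congrFun (congrArg WHDTS.Hom.onState this) x))
              (funext fun x => Subtype.ext (congrFun (congrArg WHDTS.Hom.onAction this) x)) } }
  have e : hc.desc s ≫ i = 𝟙 c.pt := hc.hom_ext fun j => by
    rw [hc.fac_assoc, Category.comp_id]
    rfl
  have eS : ∀ x, ((hc.desc s).onState x).1 = x :=
    fun x => congrFun (congrArg WHDTS.Hom.onState e) x
  have eA : ∀ x, ((hc.desc s).onAction x).1 = x :=
    fun x => congrFun (congrArg WHDTS.Hom.onAction e) x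
  refine ⟨fun x => eS x ▸ ((hc.desc s).onState x).2, fun x => eA x ▸ ((hc.desc s).onAction x).2,
    fun α l β h => ?_⟩
  have := ((hc.desc s).map_trans _ _ _ h).2
  rw [eS, eS, List.map_map] at this
  have e' : (Subtype.val ∘ (hc.desc s).onAction) = id := funext eA
  rwa [e', List.map_id] at this

end WHDTS

end HDA

namespace HDA

/-! ## Cells of labelled symmetric precubical sets -/

variable {Lab : Type u} {K K' K'' : LabSymPrecubicalSet Lab} {m n p : ℕ}

/-- The `n`-cubes of a labelled symmetric precubical set. -/
noncomputable def Cell (K : LabSymPrecubicalSet Lab) (n : ℕ) : Type u := K.left.obj (op (Box.mk n))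

namespace Cell

/-- The faces of a cube. -/
noncomputable def res (f : BoxHom m n) (x : Cell K n) : Cell K m :=
  K.left.map (Quiver.Hom.op (X := Box.mk m) (Y := Box.mk n) f) x

/-- The label of a cube. -/
noncomputable def lab (x : Cell K n) : Fin n → Lab := K.hom.app (op (Box.mk n)) x

/-- The image of a cube. -/
noncomputable def map (g : K ⟶ K') (x : Cell K n) : Cell K' n := g.left.app (op (Box.mk n)) x

/-- The vertices of a cube. -/
noncomputable def vert (x : Cell K n) (ε : Vertex n) : Cell K 0 := x.res (BoxHom.vertex ε)

theorem res_id (x : Cell K n) : x.res (BoxHom.id n) = x := K.left.map_id_apply _ x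

theorem res_comp (f : BoxHom m n) (g : BoxHom n p) (x : Cell K p) :
    x.res (f.comp g) = (x.res g).res f :=
  K.left.map_comp_apply (X := op (Box.mk p)) (Y := op (Box.mk n)) (Z := op (Box.mk m))
    (Quiver.Hom.op (X := Box.mk n) (Y := Box.mk p) g)
    (Quiver.Hom.op (X := Box.mk m) (Y := Box.mk n) f) x

theorem lab_res (f : BoxHom m n) (x : Cell K n) (i : Fin m) : (x.res f).lab i = x.lab (f.dir i) :=
  congrFun (NatTrans.naturality_apply K.hom
    (Quiver.Hom.op (X := Box.mk m) (Y := Box.mk n) f) x) i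

theorem map_res (g : K ⟶ K') (f : BoxHom m n) (x : Cell K n) :
    (x.res f).map g = (x.map g).res f :=
  NatTrans.naturality_apply g.left (Quiver.Hom.op (X := Box.mk m) (Y := Box.mk n) f) x

theorem lab_map (g : K ⟶ K') (x : Cell K n) : (x.map g).lab = x.lab :=
  ConcreteCategory.congr_hom (NatTrans.congr_app (Over.w g) (op (Box.mk n))) x

theorem map_id (x : Cell K n) : x.map (𝟙 K) = x := rfl

theorem map_comp (g : K ⟶ K') (h : K' ⟶ K'') (x : Cell K n) :
    x.map (g ≫ h) = (x.map g).map h := rfl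

theorem vert_res (f : BoxHom m n) (x : Cell K n) (ε : Vertex m) :
    (x.res f).vert ε = x.vert (f.toFun ε) :=
  (res_comp _ _ _).symm

theorem vert_map (g : K ⟶ K') (x : Cell K n) (ε : Vertex n) :
    (x.map g).vert ε = (x.vert ε).map g := (map_res _ _ _).symm

theorem vert_zero (x : Cell K 0) (ε : Vertex 0) : x.vert ε = x := by
  have : BoxHom.vertex ε = BoxHom.id 0 :=
    BoxHom.ext (funext fun _ => Subsingleton.elim _ _)
  rw [vert, this, res_id]

end Cell

/-- Every object of `Box` is some `[n]`, so maps may be compared on cells. -/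
theorem lab_hom_ext {f g : K ⟶ K'} (h : ∀ n (x : Cell K n), x.map f = x.map g) : f = g :=
  Over.OverMorphism.ext (NatTrans.ext (funext fun X =>
    ConcreteCategory.hom_ext _ _ fun x => h X.unop.dim x))

/-- Maps of labelled symmetric precubical sets, described by their action on cubes. -/
noncomputable def homOfCells (φ : ∀ n, Cell K n → Cell K' n)
    (hres : ∀ m n (f : BoxHom m n) x, φ m (x.res f) = (φ n x).res f)
    (hlab : ∀ n x, (φ n x).lab = x.lab) : K ⟶ K' :=
  Over.homMk
    { app := fun X => TypeCat.ofHom (φ X.unop.dim)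
      naturality := fun _ _ f => ConcreteCategory.hom_ext _ _ fun x => hres _ _ f.unop x }
    (NatTrans.ext (funext fun X => ConcreteCategory.hom_ext _ _ fun x => hlab X.unop.dim x))

theorem isIso_iff_cells (f : K ⟶ K') :
    IsIso f ↔ ∀ n, Function.Bijective (Cell.map f : Cell K n → Cell K' n) := by
  constructor
  · intro _ n
    refine Function.bijective_iff_has_inverse.2 ⟨Cell.map (inv f), fun x => ?_, fun x => ?_⟩
    · rw [← Cell.map_comp, IsIso.hom_inv_id, Cell.map_id]
    · rw [← Cell.map_comp, IsIso.inv_hom_id, Cell.map_id]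
  · intro h
    have : IsIso ((Over.forget _).map f) := by
      rw [NatTrans.isIso_iff_isIso_app]
      intro X
      exact (isIso_iff_bijective _).2 (h X.unop.dim)
    exact isIso_of_reflects_iso f (Over.forget _)

/-- The map from a labelled cube which corresponds to a cube of `K`. -/
noncomputable def Cell.toHom (x : Cell K n) {a : Fin n → Lab} (h : ∀ i, x.lab i = a i) :
    (labCubeFunctor Lab).obj ⟨n, a⟩ ⟶ K :=
  homOfCells (fun _ f => x.res f.down)
    (fun _ _ f g => Cell.res_comp f g.down x)
    (fun _ f => funext fun i => (Cell.lab_res f.down x i).trans (h _))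

/-- The universal cube of a labelled cube. -/
noncomputable def idCell (A : LabCube Lab) : Cell ((labCubeFunctor Lab).obj A) A.dim :=
  ULift.up (𝟙 (Box.mk A.dim))

/-- The cube of `K` which corresponds to a map from a labelled cube. -/
noncomputable def Cell.ofHom {A : LabCube Lab} (h : (labCubeFunctor Lab).obj A ⟶ K) : Cell K A.dim :=
  (idCell A).map h

theorem Cell.lab_ofHom {A : LabCube Lab} (h : (labCubeFunctor Lab).obj A ⟶ K) (i : Fin A.dim) :
    (Cell.ofHom h).lab i = A.label i :=
  (congrFun (Cell.lab_map h (idCell A)) i).trans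
    (congrArg A.label (BoxHom.dir_id i))

theorem Cell.map_eq_res_ofHom {A : LabCube Lab} (h : (labCubeFunctor Lab).obj A ⟶ K)
    (x : Cell ((labCubeFunctor Lab).obj A) n) : x.map h = (Cell.ofHom h).res x.down := by
  refine Eq.trans ?_ (Cell.map_res h x.down (idCell A))
  rfl

theorem Cell.ofHom_injective {A : LabCube Lab} {h h' : (labCubeFunctor Lab).obj A ⟶ K}
    (e : Cell.ofHom h = Cell.ofHom h') : h = h' :=
  lab_hom_ext fun n x => by rw [Cell.map_eq_res_ofHom, Cell.map_eq_res_ofHom, e]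

theorem Cell.ofHom_toHom (x : Cell K n) {a : Fin n → Lab} (h : ∀ i, x.lab i = a i) :
    Cell.ofHom (x.toHom h) = x := Cell.res_id x

theorem Cell.ofHom_comp {A : LabCube Lab} (h : (labCubeFunctor Lab).obj A ⟶ K) (g : K ⟶ K') :
    Cell.ofHom (h ≫ g) = (Cell.ofHom h).map g := rfl

theorem Cell.ofHom_map {A B : LabCube Lab} (f : A ⟶ B) (h : (labCubeFunctor Lab).obj B ⟶ K) :
    Cell.ofHom ((labCubeFunctor Lab).map f ≫ h) = (Cell.ofHom h).res f.box := by
  exact (Cell.map_eq_res_ofHom h (n := A.dim) ⟨𝟙 (Box.mk A.dim) ≫ f.box⟩).trans rfl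

/-! ## The nerve -/

/-- The nerve of a weak higher dimensional transition system: the labelled symmetric precubical set
of its cubes. -/
noncomputable def nerveObj (X : WHDTS Lab) : LabSymPrecubicalSet Lab :=
  Over.mk (Y :=
    { obj := fun B => CubeIn X B.unop.dim
      map := fun f => TypeCat.ofHom (CubeIn.res f.unop)
      map_id := fun _ => ConcreteCategory.hom_ext _ _ fun x => CubeIn.res_id x
      map_comp := fun f g => ConcreteCategory.hom_ext _ _ fun x => CubeIn.res_comp g.unop f.unop x })
    { app := fun _ => TypeCat.ofHom fun x i => X.label (x.act i)
      naturality := fun _ _ _ => rfl }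

/-- The nerve functor. -/
noncomputable def nerve (Lab : Type u) : WHDTS Lab ⥤ LabSymPrecubicalSet Lab where
  obj := nerveObj
  map {X Y} g := homOfCells (K := nerveObj X) (K' := nerveObj Y) (fun _ x => CubeIn.map g x)
    (fun _ _ _ _ => rfl) (fun _ x => funext fun i => g.label_eq (CubeIn.act x i))
  map_id _ := rfl
  map_comp _ _ := rfl

end HDA

namespace HDA

/-! ## The realization is left adjoint to the nerve -/

variable {Lab : Type u} {K K' : LabSymPrecubicalSet Lab} {m n : ℕ}

/-- The diagram whose colimit is the realization. -/
noncomputable abbrev realDiagram (K : LabSymPrecubicalSet Lab) :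
    CostructuredArrow (labCubeFunctor Lab) K ⥤ WHDTS Lab :=
  CostructuredArrow.proj (labCubeFunctor Lab) K ⋙ cubeRealization Lab

/-- The colimit cocone which defines the realization. -/
noncomputable def realCocone (K : LabSymPrecubicalSet Lab) : Cocone (realDiagram K) :=
  ⟨(realization Lab).obj K, (colimit.cocone (realDiagram K)).ι⟩

/-- The realization is a colimit. -/
noncomputable def realIsColimit (K : LabSymPrecubicalSet Lab) : IsColimit (realCocone K) :=
  colimit.isColimit (realDiagram K)

/-- The cubes of the colimit given by the cocone. -/
noncomputable def realLeg (j : CostructuredArrow (labCubeFunctor Lab) K) :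
    CubeIn ((realization Lab).obj K) j.left.dim :=
  CubeIn.ofHom (a := j.left.label) ((realCocone K).ι.app j)

/-- By Yoneda an equality of cells is a morphism of the indexing category, along which the cocone is
compatible. Labels need no separate hypothesis, being determined by the cells. -/
theorem realLeg_eq_res (j k : CostructuredArrow (labCubeFunctor Lab) K)
    (f : BoxHom j.left.dim k.left.dim) (h : Cell.ofHom j.hom = (Cell.ofHom k.hom).res f) :
    realLeg j = (realLeg k).res f := by
  let φ : j.left ⟶ k.left := ⟨f, fun i => by
    rw [← Cell.lab_ofHom k.hom, ← Cell.lab_ofHom j.hom, h, Cell.lab_res]⟩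
  have hφ : (labCubeFunctor Lab).map φ ≫ k.hom = j.hom :=
    Cell.ofHom_injective ((Cell.ofHom_map φ k.hom).trans h.symm)
  have := (realCocone K).w (CostructuredArrow.homMk φ hφ)
  exact (congrArg (CubeIn.ofHom (a := j.left.label)) this.symm).trans rfl

/-- The index of the diagram which is given by a cube of `K`. -/
noncomputable def realArrow (x : Cell K n) : CostructuredArrow (labCubeFunctor Lab) K :=
  CostructuredArrow.mk (Y := ⟨n, x.lab⟩) (x.toHom fun _ => rfl)

theorem ofHom_realArrow (x : Cell K n) : Cell.ofHom (realArrow x).hom = x :=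
  Cell.ofHom_toHom x fun _ => rfl

/-- The cube of the realization given by a cube of `K`. -/
noncomputable def realCell (x : Cell K n) : CubeIn ((realization Lab).obj K) n :=
  realLeg (realArrow x)

/-- This replaces the indexing by arrows out of labelled cubes with an indexing by cells of `K`, on
which the adjunction is then described. -/
theorem realLeg_eq (j : CostructuredArrow (labCubeFunctor Lab) K) :
    realLeg j = realCell (Cell.ofHom j.hom) := by
  refine (realLeg_eq_res j (realArrow _) (BoxHom.id _) ?_).trans (CubeIn.res_id (realCell _))
  exact ((Cell.res_id _).trans (ofHom_realArrow _)).symm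

theorem realCell_res (f : BoxHom m n) (x : Cell K n) : realCell (x.res f) = (realCell x).res f := by
  refine realLeg_eq_res (realArrow _) (realArrow x) f ?_
  exact (ofHom_realArrow _).trans (congrArg (Cell.res f) (ofHom_realArrow x).symm)

theorem label_realCell (x : Cell K n) (i : Fin n) :
    ((realization Lab).obj K).label ((realCell x).act i) = x.lab i :=
  CubeIn.label_ofHom (a := x.lab) _ i

/-- The triangle identities and naturality of the adjunction are all checked through this. -/
theorem realization_hom_ext {X : WHDTS Lab} {f g : (realization Lab).obj K ⟶ X}
    (h : ∀ n (x : Cell K n), (realCell x).map f = (realCell x).map g) : f = g :=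
  (realIsColimit K).hom_ext fun j => CubeIn.ofHom_injective (a := j.left.label) (by
    have := h _ (Cell.ofHom j.hom)
    rwa [← realLeg_eq] at this)

/-- The cocone given by a family of cubes. -/
noncomputable def realDescCocone {X : WHDTS Lab} (φ : ∀ n, Cell K n → CubeIn X n)
    (hres : ∀ m n (f : BoxHom m n) x, φ m (x.res f) = (φ n x).res f)
    (hlab : ∀ n x i, X.label ((φ n x).act i) = Cell.lab x i) : Cocone (realDiagram K) where
  pt := X
  ι :=
    { app := fun j => (φ _ (Cell.ofHom j.hom)).toHom (a := j.left.label) fun i =>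
        (hlab _ _ i).trans (Cell.lab_ofHom j.hom i)
      naturality := fun j k f => CubeIn.ofHom_injective (a := j.left.label) (by
        have := Cell.ofHom_map f.left k.hom
        rw [CostructuredArrow.w] at this
        change (φ _ (Cell.ofHom k.hom)).res f.left.box = φ _ (Cell.ofHom j.hom)
        rw [this, hres]) }

/-- The map out of the realization induced by a family of cubes. -/
noncomputable def realDesc {X : WHDTS Lab} (φ : ∀ n, Cell K n → CubeIn X n)
    (hres : ∀ m n (f : BoxHom m n) x, φ m (x.res f) = (φ n x).res f)
    (hlab : ∀ n x i, X.label ((φ n x).act i) = Cell.lab x i) :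
    (realization Lab).obj K ⟶ X :=
  (realIsColimit K).desc (realDescCocone φ hres hlab)

theorem map_realDesc {X : WHDTS Lab} (φ : ∀ n, Cell K n → CubeIn X n) (hres) (hlab)
    (x : Cell K n) : (realCell x).map (realDesc φ hres hlab) = φ n x := by
  have := (realIsColimit K).fac (realDescCocone φ hres hlab) (realArrow x)
  exact (congrArg (CubeIn.ofHom (a := x.lab)) this).trans (congrArg (φ n) (ofHom_realArrow x))

theorem realCell_map (f : K ⟶ K') (x : Cell K n) :
    (realCell x).map ((realization Lab).map f) = realCell (x.map f) := by
  refine (congrArg (CubeIn.ofHom (a := x.lab))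
    (colimit.ι_desc (F := realDiagram K) _ (realArrow x))).trans ?_
  refine (realLeg_eq ((CostructuredArrow.map f).obj (realArrow x))).trans (congrArg realCell ?_)
  exact congrArg (Cell.map f) (ofHom_realArrow x)

/-- The unit `K ⟶ N(𝕋(K))`. -/
noncomputable def realUnit (K : LabSymPrecubicalSet Lab) :
    K ⟶ (nerve Lab).obj ((realization Lab).obj K) :=
  homOfCells (K' := nerveObj _) (fun _ x => realCell x) (fun _ _ f x => realCell_res f x)
    (fun _ x => funext (label_realCell x))

/-- The counit `𝕋(N(X)) ⟶ X`. -/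
noncomputable def realCounit (X : WHDTS Lab) :
    (realization Lab).obj ((nerve Lab).obj X) ⟶ X :=
  realDesc (K := nerveObj X) (fun _ x => x) (fun _ _ _ _ => rfl) (fun _ _ _ => rfl)

theorem map_realCounit {X : WHDTS Lab} (x : CubeIn X n) :
    (realCell (K := nerveObj X) x).map (realCounit X) = x :=
  map_realDesc (K := nerveObj X) _ _ _ x

/-- The realization is left adjoint to the nerve. -/
noncomputable def realAdj (Lab : Type u) : realization Lab ⊣ nerve Lab :=
  Adjunction.mkOfUnitCounit
    { unit :=
        { app := realUnit
          naturality := fun _ _ f => lab_hom_ext fun _ x => (realCell_map f x).symm }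
      counit :=
        { app := realCounit
          naturality := fun X Y f => realization_hom_ext fun n x => by
            have h1 := congrArg (CubeIn.map (realCounit Y)) (realCell_map ((nerve Lab).map f) x)
            have h2 := congrArg (CubeIn.map f) (map_realCounit (X := X) x)
            exact h1.trans ((map_realCounit (X := Y) _).trans h2.symm) }
      left_triangle := NatTrans.ext (funext fun K => realization_hom_ext fun n x => by
        have h1 := congrArg (CubeIn.map (realCounit ((realization Lab).obj K)))
          (realCell_map (realUnit K) x)
        exact h1.trans (map_realCounit _))
      right_triangle := NatTrans.ext (funext fun X => lab_hom_ext fun n x =>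
        map_realCounit (X := X) x) }

/-! ## States and transitions of the realization -/

/-- The cubes of the realization which come from cubes of `K`. -/
def realCubes (K : LabSymPrecubicalSet Lab) (n : ℕ) : Set (CubeIn ((realization Lab).obj K) n) :=
  Set.range (realCell (K := K))

/-- The state of the realization given by a vertex. -/
noncomputable def realState (x : Cell K 0) : ((realization Lab).obj K).State :=
  (realCell x).vert Fin.elim0

theorem vert_realCell (x : Cell K n) (ε : Vertex n) :
    (realCell x).vert ε = realState (x.vert ε) := by
  rw [realState, Cell.vert, realCell_res]
  rfl

/-- The system with all possible transitions. -/
def codiscrete (Lab S : Type u) : WHDTS Lab where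
  State := S
  Action := Lab
  label a := a
  trans _ l _ := l ≠ []
  ne_nil h := h
  multiset hp h := fun h0 => h (by subst h0; exact hp.eq_nil)
  coherence _ h _ _ _ _ _ _ := h

/-- The vertices of `K` label the states of a codiscrete system, in which every nonempty list of
actions is a transition. The cells of `K` therefore map there freely, and the resulting map out of
the realization recovers each vertex from its state. -/
theorem realState_injective : Function.Injective (realState (K := K)) := by
  let f : (realization Lab).obj K ⟶ codiscrete Lab (Cell K 0) :=
    realDesc (X := codiscrete Lab (Cell K 0))
      (fun n x => ⟨x.vert, x.lab, fun _ _ _ h => map_ne_nil _ h.1⟩)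
      (fun m n f x => CubeIn.ext (funext fun ε => Cell.vert_res f x ε)
        (funext fun i => Cell.lab_res f x i)) (fun _ _ _ => rfl)
  have hf : ∀ x : Cell K 0, f.onState (realState x) = x := fun x =>
    (congrFun (congrArg CubeIn.vert (map_realDesc _ _ _ x)) Fin.elim0).trans
      (Cell.vert_zero x Fin.elim0)
  intro x y h
  rw [← hf x, h, hf]

theorem realization_induction (PS : ((realization Lab).obj K).State → Prop)
    (PT : ((realization Lab).obj K).State → List ((realization Lab).obj K).Action →
      ((realization Lab).obj K).State → Prop)
    (hS : ∀ x, PS (realState x))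
    (hT : ∀ α l β, WHDTS.FromCubes (realCubes K) α l β → PT α l β)
    (hm : ∀ α l l' β, l.Perm l' → PT α l β → PT α l' β)
    (hcoh : ∀ α β ν₁ ν₂ l₁ l₂ l₃, l₁ ≠ [] → l₂ ≠ [] → l₃ ≠ [] → PT α (l₁ ++ l₂ ++ l₃) β →
      PT α l₁ ν₁ → PT ν₁ (l₂ ++ l₃) β → PT α (l₁ ++ l₂) ν₂ → PT ν₂ l₃ β → PT ν₁ l₂ ν₂) :
    (∀ s, PS s) ∧ ∀ α l β, ((realization Lab).obj K).trans α l β → PT α l β := by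
  have := WHDTS.colimit_induction (realIsColimit K) PS (fun _ => True) PT
    (fun j s => by
      have h := vert_realCell (Cell.ofHom j.hom) s.down
      rw [← realLeg_eq] at h
      exact (congrArg PS h).mpr (hS _))
    (fun _ _ => trivial)
    (fun j α l β h => hT _ _ _ ⟨_, realLeg j, ⟨_, (realLeg_eq j).symm⟩, α.down, l.map ULift.down,
      β.down, CubeIn.cubeTrans_of_trans h, rfl, List.map_map, rfl⟩)
    hm hcoh
  exact ⟨this.1, this.2.2⟩

end HDA

namespace HDA

/-! ## Characterization of the objects of `HDA_hdts` -/

variable {Lab : Type u} {K K' : LabSymPrecubicalSet Lab} {m n p : ℕ}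

/-- Cubes are determined by their labels and their vertices. -/
def Separated (K : LabSymPrecubicalSet Lab) : Prop :=
  ∀ n (x y : Cell K n), x.lab = y.lab → x.vert = y.vert → x = y

/-- The map from the unlabelled cube given by a cube. -/
noncomputable def Cell.yoneda (x : Cell K n) : stdCube.{u} n ⟶ K.left :=
  (x.toHom (a := x.lab) fun _ => rfl).left

/-- The cubes of `□_S[n]`. -/
def stdCell (f : BoxHom m n) : (stdCube.{u} n).obj (op (Box.mk m)) := ULift.up f

theorem app_stdCell {P : SymPrecubicalSet.{u}} (g : stdCube.{u} n ⟶ P) (f : BoxHom m n) :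
    g.app (op (Box.mk m)) (stdCell f) =
      P.map (Quiver.Hom.op (X := Box.mk m) (Y := Box.mk n) f)
        (g.app (op (Box.mk n)) (stdCell (BoxHom.id n))) :=
  NatTrans.naturality_apply g (Quiver.Hom.op (X := Box.mk m) (Y := Box.mk n) f)
    (stdCell (BoxHom.id n))

/-- Since `p ≥ 1`, the boundary contains all vertices of the cube, while the square fixes the
labels. Two fillers thus agree on the top cell and, by Yoneda, everywhere. -/
theorem Separated.atMostOneFiller (h : Separated K) (hp : 1 ≤ p) : AtMostOneFiller p K := by
  intro f g sq
  refine ⟨fun l₁ l₂ => ?_⟩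
  have key : l₁.l.app (op (Box.mk p)) (stdCell (BoxHom.id p)) =
      l₂.l.app (op (Box.mk p)) (stdCell (BoxHom.id p)) := by
    refine h p _ _ ?_ (funext fun ε => ?_)
    · have h1 := ConcreteCategory.congr_hom (NatTrans.congr_app
        (l₁.fac_right.trans l₂.fac_right.symm) (op (Box.mk p))) (stdCell (BoxHom.id p))
      exact h1
    · have h1 := ConcreteCategory.congr_hom (NatTrans.congr_app
        (l₁.fac_left.trans l₂.fac_left.symm) (op (Box.mk 0)))
        (⟨stdCell (BoxHom.vertex ε), hp⟩ : (boundary.{u} p).toFunctor.obj (op (Box.mk 0)))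
      exact ((app_stdCell l₁.l (BoxHom.vertex ε)).symm.trans h1).trans
        (app_stdCell l₂.l (BoxHom.vertex ε))
  refine CommSq.LiftStruct.ext (NatTrans.ext (funext fun X =>
    ConcreteCategory.hom_ext _ _ fun x => ?_))
  have h1 := app_stdCell (m := X.unop.dim) l₁.l x.down
  have h2 := app_stdCell (m := X.unop.dim) l₂.l x.down
  rw [key] at h1
  exact h1.trans h2.symm

/-- Induction on dimension: two cells with the same labels and vertices have, by induction, the same
proper faces, so both fill the same labelled shell. -/
theorem separated_of_atMostOneFiller (h : ∀ p, 1 ≤ p → AtMostOneFiller p K) : Separated K := by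
  intro n
  induction n using Nat.strong_induction_on with
  | _ n ih =>
    intro x y hl hv
    obtain rfl | hn := Nat.eq_zero_or_pos n
    · rw [← x.vert_zero Fin.elim0, hv, y.vert_zero]
    · have sq : CommSq ((boundary.{u} n).ι ≫ x.yoneda) (boundary.{u} n).ι K.hom
        (x.yoneda ≫ K.hom) := ⟨rfl⟩
      have := h n hn _ _ sq
      -- Both `x` and `y` lift the square built from the boundary and the labels of `x`; the
      -- induction hypothesis is needed only to place `y` over that boundary.
      let l₁ : sq.LiftStruct := ⟨x.yoneda, rfl, rfl⟩
      let l₂ : sq.LiftStruct := ⟨y.yoneda, by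
        refine NatTrans.ext (funext fun X => ConcreteCategory.hom_ext _ _ fun f => ?_)
        refine ih X.unop.dim f.2 (y.res f.1.down) (x.res f.1.down) (funext fun i => ?_)
          (funext fun ε => ?_)
        · rw [Cell.lab_res, Cell.lab_res, hl]
        · rw [Cell.vert_res, Cell.vert_res, hv], by
        refine NatTrans.ext (funext fun X => ConcreteCategory.hom_ext _ _ fun f => ?_)
        refine funext fun i => ?_
        refine (Cell.lab_res f.down y i).trans (Eq.trans ?_ (Cell.lab_res f.down x i).symm)
        rw [hl]⟩
      have e : x.yoneda = y.yoneda := congrArg CommSq.LiftStruct.l (Subsingleton.elim l₁ l₂)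
      have e' := ConcreteCategory.congr_hom (NatTrans.congr_app e (op (Box.mk n)))
        (stdCell (BoxHom.id n))
      exact (x.res_id.symm.trans e').trans y.res_id

/-- If intermediate states are unique, then all transitions of the realization come from cubes. -/
theorem fromCubes_of_trans (hU : ((realization Lab).obj K).UniqueIntermediate) {α l β}
    (t : ((realization Lab).obj K).trans α l β) : WHDTS.FromCubes (realCubes K) α l β :=
  (realization_induction (fun _ => True) (WHDTS.FromCubes (realCubes K)) (fun _ => trivial)
    (fun _ _ _ h => h) (fun _ _ _ _ hp h => h.multiset hp)
    (fun _ _ _ _ _ _ _ h₁ h₂ h₃ t t₁ t₂ t₃ t₄ => WHDTS.FromCubes.coherence hU h₁ h₂ h₃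
      t t₁ t₂ t₃ t₄)).2 α l β t

theorem realState_surjective : Function.Surjective (realState (K := K)) :=
  (realization_induction (fun s => ∃ x, realState x = s) (fun _ _ _ => True) (fun x => ⟨x, rfl⟩)
    (fun _ _ _ _ => trivial) (fun _ _ _ _ _ _ => trivial)
    (fun _ _ _ _ _ _ _ _ _ _ _ _ _ _ _ => trivial)).1

/-- A one-action transition comes from a direction of a cube, hence from a `1`-cell of `K`. Its end
vertices are recovered from the end states by `realState_injective`, and a `1`-cell is determined by
these and its label. -/
theorem Separated.csa1 (hK : Separated K) (hU : ((realization Lab).obj K).UniqueIntermediate) :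
    ((realization Lab).obj K).CSA1 := by
  have key : ∀ {α u β}, ((realization Lab).obj K).trans α [u] β → ∃ e : Cell K 1,
      realState (e.vert fun _ => false) = α ∧ realState (e.vert fun _ => true) = β ∧
        (realCell e).act 0 = u := by
    intro α u β t
    obtain ⟨n, _, ⟨x, rfl⟩, α, l, β, h, rfl, e, rfl⟩ := fromCubes_of_trans hU t
    obtain ⟨i, rfl, rfl⟩ := List.map_eq_singleton_iff.1 e
    obtain ⟨f, hd, rfl, rfl⟩ := BoxHom.exists_face (d := fun _ : Fin 1 => i) h
    refine ⟨x.res f, ?_, ?_, ?_⟩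
    · rw [Cell.vert_res, vert_realCell]
    · rw [Cell.vert_res, vert_realCell]
    · rw [realCell_res]
      exact congrArg (realCell x).act (congrFun hd 0)
  intro α β u u' t t' hl
  obtain ⟨e, e0, e1, rfl⟩ := key t
  obtain ⟨e', e0', e1', rfl⟩ := key t'
  rw [label_realCell, label_realCell] at hl
  have : e = e' := by
    refine hK 1 _ _ (funext fun i => ?_) (funext fun ε => ?_)
    · rwa [Subsingleton.elim i 0]
    · have hε : ε = fun _ => ε 0 := funext fun i => congrArg ε (Subsingleton.elim i 0)
      rw [hε]
      cases ε 0
      · exact realState_injective (e0.trans e0'.symm)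
      · exact realState_injective (e1.trans e1'.symm)
  rw [this]

/-- An object of `HDA_hdts` is a labelled symmetric precubical set whose cubes are determined by
their labels and their vertices and whose realization has unique intermediate states. -/
theorem isHDAhdts_iff : isHDAhdts Lab K ↔
    Separated K ∧ ((realization Lab).obj K).UniqueIntermediate := by
  refine ⟨fun h => ⟨separated_of_atMostOneFiller fun p hp => ?_, h.2.2.2.1.uniqueIntermediate⟩,
    fun h => ⟨fun p hp => h.1.atMostOneFiller (by omega), h.1.atMostOneFiller le_rfl,
      h.1.csa1 h.2, h.2.csa2 fun _ _ _ => fromCubes_of_trans h.2,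
      h.2.csa3 fun _ _ _ => fromCubes_of_trans h.2⟩⟩
  obtain rfl | hp := hp.eq_or_lt
  · exact h.2.1
  · exact h.1 p hp

theorem onState_realization_map (f : K ⟶ K') (x : Cell K 0) :
    ((realization Lab).map f).onState (realState x) = realState (x.map f) :=
  congrFun (congrArg CubeIn.vert (realCell_map f x)) Fin.elim0

/-- A labelled symmetric precubical set belongs to `HDA_hdts` if its cubes are separated by maps to
objects of `HDA_hdts`. -/
theorem isHDAhdts_of_jointly_injective (h : ∀ n (x y : Cell K n), x.lab = y.lab →
    (∀ K' (f : K ⟶ K'), isHDAhdts Lab K' → x.map f = y.map f) → x = y) : isHDAhdts Lab K := by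
  refine isHDAhdts_iff.2 ⟨fun n x y hl hv => h n x y hl fun K' f hK' => ?_, ?_⟩
  · refine (isHDAhdts_iff.1 hK').1 n _ _ (by rw [Cell.lab_map, Cell.lab_map, hl])
      (funext fun ε => ?_)
    rw [Cell.vert_map, Cell.vert_map, hv]
  · intro α l₁ l₂ β ν ν' h₁ h₂ t a b a' b'
    obtain ⟨x, rfl⟩ := realState_surjective ν
    obtain ⟨y, rfl⟩ := realState_surjective ν'
    -- Joint injectivity is used on vertices only. The two intermediate states coincide after each
    -- test map, whose target has unique intermediate states.
    refine congrArg _ (h 0 x y (funext fun i => i.elim0) fun K' f hK' => ?_)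
    apply realState_injective
    rw [← onState_realization_map, ← onState_realization_map]
    have hm := ((realization Lab).map f).map_trans
    have t' := hm _ _ _ t
    rw [List.map_append] at t'
    exact (isHDAhdts_iff.1 hK').2 (map_ne_nil _ h₁) (map_ne_nil _ h₂) t' (hm _ _ _ a) (hm _ _ _ b)
      (hm _ _ _ a') (hm _ _ _ b')

/-- The nerve of a higher dimensional transition system belongs to `HDA_hdts`. -/
theorem isHDAhdts_nerve {X : WHDTS Lab} (hX : isHDTS Lab X) :
    isHDAhdts Lab ((nerve Lab).obj X) := by
  refine isHDAhdts_iff.2 ⟨fun n x y hl hv => ?_, ?_⟩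
  · exact hX.1.cube_ext (x := x) (y := y)
      (funext fun ε => congrFun (congrArg CubeIn.vert (congrFun hv ε)) Fin.elim0) (congrFun hl)
  · refine hX.2.1.uniqueIntermediate.of_hom (realCounit X) fun s t h => ?_
    obtain ⟨x, rfl⟩ := realState_surjective s
    obtain ⟨y, rfl⟩ := realState_surjective t
    have key : ∀ z : CubeIn X 0, (realCounit X).onState (realState (K := nerveObj X) z) =
      z.vert Fin.elim0 := fun z => congrFun (congrArg CubeIn.vert (map_realCounit z)) Fin.elim0
    have e := ((key x).symm.trans h).trans (key y)
    refine congrArg _ (CubeIn.ext (x := x) (y := y) (funext fun ε => ?_) (funext fun i => i.elim0))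
    rw [Subsingleton.elim ε Fin.elim0]
    exact e

/-- The unit is an isomorphism at the objects of `HDA_hdts`. -/
theorem isIso_realUnit (hK : isHDAhdts Lab K) : IsIso (realUnit K) := by
  obtain ⟨hS, hU⟩ := isHDAhdts_iff.1 hK
  refine (isIso_iff_cells _).2 fun n => ⟨fun x y h => ?_, fun c => ?_⟩
  · refine hS n x y ?_ (funext fun ε => realState_injective ?_)
    · rw [← Cell.lab_map (realUnit K) x, h, Cell.lab_map]
    · rw [← vert_realCell, ← vert_realCell]
      exact congrFun (congrArg CubeIn.vert h) ε
  · obtain rfl | hn := eq_or_ne n 0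
    · obtain ⟨x, hx⟩ := realState_surjective ((show CubeIn _ 0 from c).vert Fin.elim0)
      refine ⟨x, CubeIn.ext (x := realCell x) (funext fun ε => ?_) (funext fun i => i.elim0)⟩
      rw [Subsingleton.elim ε Fin.elim0]
      exact hx
    · exact hU.mem_of_fromCubes (fun _ _ _ => fromCubes_of_trans hU)
        (by rintro m n f _ ⟨x, rfl⟩; exact ⟨x.res f, realCell_res f x⟩) hn c

end HDA

namespace HDA

/-! ## The reflection onto `HDA_hdts` -/

variable {Lab : Type u}

/-- Two cubes are identified if they have the same label and the same image under all maps to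
objects of `HDA_hdts`. -/
def reflRel (K : LabSymPrecubicalSet Lab) (n : ℕ) (x y : Cell K n) : Prop :=
  -- The quantification ranges over all objects of `isHDAhdts` but only defines a proposition, so no
  -- solution set is needed.
  x.lab = y.lab ∧ ∀ K' (f : K ⟶ K'), isHDAhdts Lab K' → x.map f = y.map f

theorem reflRel.res {K : LabSymPrecubicalSet Lab} {m n : ℕ} (f : BoxHom m n) {x y : Cell K n}
    (h : reflRel K n x y) : reflRel K m (x.res f) (y.res f) := by
  refine ⟨funext fun i => ?_, fun K' g hK' => ?_⟩
  · rw [Cell.lab_res, Cell.lab_res, h.1]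
  · rw [Cell.map_res, Cell.map_res, h.2 K' g hK']

/-- The reflection of a labelled symmetric precubical set. -/
noncomputable def reflObj (K : LabSymPrecubicalSet Lab) : LabSymPrecubicalSet Lab :=
  Over.mk (Y :=
    { obj := fun B => Quot (reflRel K B.unop.dim)
      map := fun f => TypeCat.ofHom (Quot.map (Cell.res f.unop) fun _ _ h => h.res f.unop)
      map_id := fun _ => ConcreteCategory.hom_ext _ _ fun x => by
        induction x using Quot.ind with
        | mk x => exact congrArg (Quot.mk _) (Cell.res_id x)
      map_comp := fun f g => ConcreteCategory.hom_ext _ _ fun x => by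
        induction x using Quot.ind with
        | mk x => exact congrArg (Quot.mk _) (Cell.res_comp g.unop f.unop x) })
    { app := fun _ => TypeCat.ofHom (Quot.lift Cell.lab fun _ _ h => h.1)
      naturality := fun _ _ f => ConcreteCategory.hom_ext _ _ fun x => by
        induction x using Quot.ind with
        | mk x => exact funext (Cell.lab_res f.unop x) }

/-- The map to the reflection. -/
noncomputable def reflMap (K : LabSymPrecubicalSet Lab) : K ⟶ reflObj K :=
  homOfCells (K' := reflObj K) (fun n x => Quot.mk (reflRel K n) x) (fun _ _ _ _ => rfl)
    (fun _ _ => rfl)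

theorem reflMap_surjective (K : LabSymPrecubicalSet Lab) {n : ℕ} (x : Cell (reflObj K) n) :
    ∃ y : Cell K n, y.map (reflMap K) = x := Quot.exists_rep x

/-- The factorization of a map to an object of `HDA_hdts` through the reflection. -/
noncomputable def reflDesc {K K' : LabSymPrecubicalSet Lab} (hK' : isHDAhdts Lab K')
    (f : K ⟶ K') : reflObj K ⟶ K' :=
  homOfCells (K := reflObj K)
    (fun _ x => Quot.lift (Cell.map f) (fun _ _ h => h.2 K' f hK') x)
    (fun _ _ g x => by
      induction x using Quot.ind with
      | mk x => exact Cell.map_res f g x)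
    (fun _ x => by
      induction x using Quot.ind with
      | mk x => exact Cell.lab_map f x)

theorem reflMap_desc {K K' : LabSymPrecubicalSet Lab} (hK' : isHDAhdts Lab K') (f : K ⟶ K') :
    reflMap K ≫ reflDesc hK' f = f := rfl

/-- Test maps out of `K` factor through the quotient, so they separate its cells with equal labels
by the very definition of the relation. -/
theorem isHDAhdts_reflObj (K : LabSymPrecubicalSet Lab) : isHDAhdts Lab (reflObj K) := by
  refine isHDAhdts_of_jointly_injective fun n x y hl h => ?_
  obtain ⟨x, rfl⟩ := reflMap_surjective K x
  obtain ⟨y, rfl⟩ := reflMap_surjective K y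
  rw [Cell.lab_map, Cell.lab_map] at hl
  exact Quot.sound ⟨hl, fun K' f hK' => h K' (reflDesc hK' f) hK'⟩

/-- `HDA_hdts` is a reflective subcategory. -/
theorem isRightAdjoint_ι (Lab : Type u) : (isHDAhdts Lab).ι.IsRightAdjoint := by
  have (K : LabSymPrecubicalSet Lab) : HasInitial (StructuredArrow K (isHDAhdts Lab).ι) := by
    refine IsInitial.hasInitial (X := StructuredArrow.mk (S := K) (T := (isHDAhdts Lab).ι)
      (Y := (⟨reflObj K, isHDAhdts_reflObj K⟩ : (isHDAhdts Lab).FullSubcategory)) (reflMap K)) (IsInitial.ofUniqueHom (fun Y =>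
        StructuredArrow.homMk (ObjectProperty.homMk (reflDesc Y.right.property Y.hom))
          (reflMap_desc Y.right.property Y.hom)) fun Y f => ?_)
    refine StructuredArrow.hom_ext _ _ (ObjectProperty.hom_ext _ (lab_hom_ext fun n x => ?_))
    -- Uniqueness of the factorization, because the quotient map is surjective on cells.
    obtain ⟨x, rfl⟩ := reflMap_surjective K x
    exact congrArg (fun g => Cell.map g x) (StructuredArrow.w f)
  exact isRightAdjointOfStructuredArrowInitials _

/-! ## Filtered colimits -/

section Filtered

variable {J : Type u} [SmallCategory J]

/-- A property of the arrows out of `j` holds eventually. -/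
def EvAfter (j : J) (P : ∀ k, (j ⟶ k) → Prop) : Prop :=
  ∃ (k : J) (f : j ⟶ k), ∀ (l : J) (g : k ⟶ l), P l (f ≫ g)

theorem EvAfter.mono {j : J} {P Q : ∀ k, (j ⟶ k) → Prop} (h : EvAfter j P)
    (hPQ : ∀ k f, P k f → Q k f) : EvAfter j Q := by
  obtain ⟨k, f, h⟩ := h
  exact ⟨k, f, fun l g => hPQ _ _ (h l g)⟩

theorem EvAfter.exists {j : J} {P : ∀ k, (j ⟶ k) → Prop} (h : EvAfter j P) : ∃ k f, P k f := by
  obtain ⟨k, f, h⟩ := h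
  exact ⟨k, _, h k (𝟙 k)⟩

theorem EvAfter.of_comp {i j : J} (u : i ⟶ j) {P : ∀ k, (i ⟶ k) → Prop}
    (h : EvAfter j fun k f => P k (u ≫ f)) : EvAfter i P := by
  obtain ⟨k, f, h⟩ := h
  exact ⟨k, u ≫ f, fun l g => by rw [Category.assoc]; exact h l g⟩

theorem EvAfter.and [IsFiltered J] {j : J} {P Q : ∀ k, (j ⟶ k) → Prop} (hP : EvAfter j P)
    (hQ : EvAfter j Q) : EvAfter j fun k f => P k f ∧ Q k f := by
  obtain ⟨k, f, hP⟩ := hP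
  obtain ⟨k', f', hQ⟩ := hQ
  obtain ⟨l, g, g', e⟩ := IsFiltered.span f f'
  refine ⟨l, f ≫ g, fun m h => ⟨?_, ?_⟩⟩
  · rw [Category.assoc]; exact hP _ _
  · rw [e, Category.assoc]; exact hQ _ _

/-- Finiteness matters here: it is what allows the `2ⁿ` vertices of a cell to be compared at a
single stage. -/
theorem EvAfter.forall [IsFiltered J] {j : J} {ι : Type*} [Finite ι]
    {P : ι → ∀ k, (j ⟶ k) → Prop} (h : ∀ i, EvAfter j (P i)) :
    EvAfter j fun k f => ∀ i, P i k f := by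
  classical
  have := Fintype.ofFinite ι
  suffices ∀ s : Finset ι, EvAfter j fun k f => ∀ i ∈ s, P i k f from
    (this Finset.univ).mono fun k f h i => h i (Finset.mem_univ i)
  intro s
  induction s using Finset.induction_on with
  | empty => exact ⟨j, 𝟙 j, by simp⟩
  | insert i s _ ih =>
    refine ((h i).and ih).mono fun k f h' => ?_
    simpa using h'

namespace WHDTS

variable {F : J ⥤ WHDTS Lab} {c : Cocone F}

theorem onState_w {i j : J} (f : i ⟶ j) (x : (F.obj i).State) :
    (c.ι.app j).onState ((F.map f).onState x) = (c.ι.app i).onState x :=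
  congrFun (congrArg WHDTS.Hom.onState (c.w f)) x

theorem map_onState_w {i j : J} (f : i ⟶ j) (l : List (F.obj i).State) :
    (l.map (F.map f).onState).map (c.ι.app j).onState = l.map (c.ι.app i).onState := by
  rw [List.map_map]
  exact congrArg (fun g => List.map g l) (congrArg WHDTS.Hom.onState (c.w f))

theorem map_onAction_w {i j : J} (f : i ⟶ j) (l : List (F.obj i).Action) :
    (l.map (F.map f).onAction).map (c.ι.app j).onAction = l.map (c.ι.app i).onAction := by
  rw [List.map_map]
  exact congrArg (fun g => List.map g l) (congrArg WHDTS.Hom.onAction (c.w f))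

theorem map_onState_comp {i j k : J} (f : i ⟶ j) (g : j ⟶ k) (x : (F.obj i).State) :
    (F.map (f ≫ g)).onState x = (F.map g).onState ((F.map f).onState x) := by
  rw [F.map_comp]; rfl

theorem map_onAction_comp {i j k : J} (f : i ⟶ j) (g : j ⟶ k) (l : List (F.obj i).Action) :
    l.map (F.map (f ≫ g)).onAction = (l.map (F.map f).onAction).map (F.map g).onAction := by
  rw [F.map_comp, List.map_map]; rfl

end WHDTS

variable [IsFiltered J]

theorem evAfter_map_eq {F : J ⥤ Type u} {c : Cocone F} (hc : IsColimit c) {j : J} {x y : F.obj j}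
    (h : c.ι.app j x = c.ι.app j y) : EvAfter j fun _ f => F.map f x = F.map f y := by
  obtain ⟨k, f, e⟩ := (Types.FilteredColimit.isColimit_eq_iff' hc x y).1 h
  exact ⟨k, f, fun l g =>
    (F.map_comp_apply f g x).trans ((congrArg (F.map g) e).trans (F.map_comp_apply f g y).symm)⟩

theorem evAfter_list_map_eq {F : J ⥤ Type u} {c : Cocone F} (hc : IsColimit c) {j : J}
    (l l' : List (F.obj j)) (h : l.map (c.ι.app j) = l'.map (c.ι.app j)) :
    EvAfter j fun _ f => l.map (F.map f) = l'.map (F.map f) := by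
  induction l generalizing l' with
  | nil =>
    obtain rfl : l' = [] := by simpa using h.symm
    exact ⟨j, 𝟙 j, by simp⟩
  | cons a l ih =>
    cases l' with
    | nil => simp at h
    | cons b l' =>
      simp only [List.map_cons, List.cons.injEq] at h
      refine ((evAfter_map_eq hc h.1).and (ih l' h.2)).mono fun k f h' => ?_
      simp [h'.1, h'.2]

theorem exists_list_map_eq {F : J ⥤ Type u} {c : Cocone F} (hc : IsColimit c)
    (l : List c.pt) : ∃ j, ∃ l' : List (F.obj j), l'.map (c.ι.app j) = l := by
  induction l with
  | nil => exact ⟨IsFiltered.nonempty.some, [], rfl⟩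
  | cons a l ih =>
    obtain ⟨j, l, rfl⟩ := ih
    obtain ⟨i, a, rfl⟩ := Types.jointly_surjective_of_isColimit hc a
    refine ⟨IsFiltered.max i j, F.map (IsFiltered.leftToMax i j) a ::
      l.map (F.map (IsFiltered.rightToMax i j)), ?_⟩
    have h : ∀ {i j} (f : i ⟶ j) x, c.ι.app j (F.map f x) = c.ι.app i x :=
      fun f x => ConcreteCategory.congr_hom (c.w f) x
    rw [List.map_cons, List.map_map, h]
    congr 2
    exact funext fun x => h _ x

/-! ### Transitions of filtered colimits of systems. -/

namespace WHDTS

variable {F : J ⥤ WHDTS Lab} {c : Cocone F}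

instance : PreservesColimit F (stateFunctor Lab) :=
  preservesColimit_of_preserves_colimit_cocone (colimIsColimit F)
    (IsColimit.ofIsoColimit (colimit.isColimit (F ⋙ stateFunctor Lab))
      (Cocone.ext (Iso.refl _) fun _ => rfl))

instance : PreservesColimit F (actionFunctor Lab) :=
  preservesColimit_of_preserves_colimit_cocone (colimIsColimit F)
    (IsColimit.ofIsoColimit (colimit.isColimit (F ⋙ actionFunctor Lab))
      (Cocone.ext (Iso.refl _) fun _ => rfl))

/-- The transitions of a colimit which come from the components. -/
def StageTrans (c : Cocone F) (α : c.pt.State) (l : List c.pt.Action) (β : c.pt.State) : Prop :=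
  ∃ j α' l' β', (F.obj j).trans α' l' β' ∧ (c.ι.app j).onState α' = α ∧
    l'.map (c.ι.app j).onAction = l ∧ (c.ι.app j).onState β' = β

theorem evAfter_onState_eq (hc : IsColimit c) {j : J} {x y : (F.obj j).State}
    (h : (c.ι.app j).onState x = (c.ι.app j).onState y) :
    EvAfter j fun _ f => (F.map f).onState x = (F.map f).onState y :=
  evAfter_map_eq (isColimitOfPreserves (stateFunctor Lab) hc) h

theorem evAfter_onAction_eq (hc : IsColimit c) {j : J} {l l' : List (F.obj j).Action}
    (h : l.map (c.ι.app j).onAction = l'.map (c.ι.app j).onAction) :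
    EvAfter j fun _ f => l.map (F.map f).onAction = l'.map (F.map f).onAction :=
  evAfter_list_map_eq (isColimitOfPreserves (actionFunctor Lab) hc) l l' h

/-- The witnessing transition may live at an unrelated stage with other representatives. A common
stage is chosen, and the finitely many equalities of states and actions hold eventually after it. -/
theorem StageTrans.evAfter (hc : IsColimit c) {j : J} {α β : (F.obj j).State}
    {l : List (F.obj j).Action} (h : StageTrans c ((c.ι.app j).onState α)
      (l.map (c.ι.app j).onAction) ((c.ι.app j).onState β)) :
    EvAfter j fun k f => (F.obj k).trans ((F.map f).onState α) (l.map (F.map f).onAction)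
      ((F.map f).onState β) := by
  obtain ⟨i, α', l', β', t, e₁, e₂, e₃⟩ := h
  let u := IsFiltered.leftToMax i j
  let v := IsFiltered.rightToMax i j
  refine EvAfter.of_comp v ?_
  have h₁ := evAfter_onState_eq hc (x := (F.map u).onState α') (y := (F.map v).onState α)
    (by rw [onState_w, onState_w, e₁])
  have h₂ := evAfter_onAction_eq hc (l := l'.map (F.map u).onAction)
    (l' := l.map (F.map v).onAction) (by rw [map_onAction_w, map_onAction_w, e₂])
  have h₃ := evAfter_onState_eq hc (x := (F.map u).onState β') (y := (F.map v).onState β)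
    (by rw [onState_w, onState_w, e₃])
  refine ((h₁.and h₂).and h₃).mono fun k f h => ?_
  rw [map_onState_comp, map_onState_comp, map_onAction_comp, ← h.1.1, ← h.1.2, ← h.2]
  exact (F.map f).map_trans _ _ _ ((F.map u).map_trans _ _ _ t)

/-- States and lists of actions of a filtered colimit come from a common component. -/
theorem exists_stage (hc : IsColimit c) (s : List c.pt.State) (l : List c.pt.Action) :
    ∃ j, ∃ (s' : List (F.obj j).State) (l' : List (F.obj j).Action),
      s'.map (c.ι.app j).onState = s ∧ l'.map (c.ι.app j).onAction = l := by
  obtain ⟨i, s, rfl⟩ := exists_list_map_eq (isColimitOfPreserves (stateFunctor Lab) hc) s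
  obtain ⟨j, l, rfl⟩ := exists_list_map_eq (isColimitOfPreserves (actionFunctor Lab) hc) l
  refine ⟨IsFiltered.max i j, s.map (F.map (IsFiltered.leftToMax i j)).onState,
    l.map (F.map (IsFiltered.rightToMax i j)).onAction, map_onState_w _ _, map_onAction_w _ _⟩

/-- In a filtered colimit the closure under Coherence adds nothing: the five premises already hold
at one common stage, where the axiom applies. -/
theorem stageTrans_of_trans (hc : IsColimit c) {α l β} (t : c.pt.trans α l β) :
    StageTrans c α l β := by
  refine (colimit_induction hc (fun _ => True) (fun _ => True) (StageTrans c) (fun _ _ => trivial)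
    (fun _ _ => trivial) (fun j α l β t => ⟨j, α, l, β, t, rfl, rfl, rfl⟩) ?_ ?_).2.2 α l β t
  · rintro α l l' β hp ⟨j, α, k, β, t, rfl, rfl, rfl⟩
    obtain ⟨k', e, hk⟩ := (congrFun (congrFun
      (List.eq_map_comp_perm (c.ι.app j).onAction) l') k).mpr hp.symm
    exact ⟨j, α, k', β, (F.obj j).multiset hk.symm t, rfl, e.symm, rfl⟩
  · intro α β ν₁ ν₂ l₁ l₂ l₃ h₁ h₂ h₃ t t₁ t₂ t₃ t₄
    obtain ⟨j, s, l, hs, hl⟩ := exists_stage hc [α, β, ν₁, ν₂] (l₁ ++ l₂ ++ l₃)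
    obtain ⟨l', l₃, rfl, hl', rfl⟩ := List.map_eq_append_iff.1 hl
    obtain ⟨l₁, l₂, rfl, rfl, rfl⟩ := List.map_eq_append_iff.1 hl'
    simp only [List.map_eq_cons_iff, List.map_eq_nil_iff] at hs
    obtain ⟨α, _, rfl, rfl, β, _, rfl, rfl, ν₁, _, rfl, rfl, ν₂, _, rfl, rfl, rfl⟩ := hs
    simp only [← List.map_append] at t t₁ t₂ t₃ t₄
    obtain ⟨k, f, ⟨⟨⟨⟨t, t₁⟩, t₂⟩, t₃⟩, t₄⟩⟩ := ((((t.evAfter hc).and (t₁.evAfter hc)).and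
      (t₂.evAfter hc)).and (t₃.evAfter hc)).and (t₄.evAfter hc) |>.exists
    simp only [List.map_append] at t t₁ t₂ t₃ t₄
    have := (F.obj k).coherence (by simpa using h₁) (by simpa using h₂) (by simpa using h₃)
      t t₁ t₂ t₃ t₄
    exact ⟨k, _, _, _, this, onState_w _ _, map_onAction_w _ _, onState_w _ _⟩

/-- Uniqueness of intermediate states is stable under filtered colimits. -/
theorem uniqueIntermediate_of_isColimit (hc : IsColimit c)
    (hF : ∀ j, (F.obj j).UniqueIntermediate) : c.pt.UniqueIntermediate := by
  intro α l₁ l₂ β ν ν' h₁ h₂ t a b a' b'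
  obtain ⟨j, s, l, hs, hl⟩ := exists_stage hc [α, β, ν, ν'] (l₁ ++ l₂)
  obtain ⟨l₁, l₂, rfl, rfl, rfl⟩ := List.map_eq_append_iff.1 hl
  simp only [List.map_eq_cons_iff, List.map_eq_nil_iff] at hs
  obtain ⟨α, _, rfl, rfl, β, _, rfl, rfl, ν, _, rfl, rfl, ν', _, rfl, rfl, rfl⟩ := hs
  rw [← List.map_append] at t
  have ev := fun {α l β} (t : c.pt.trans _ _ _) => (stageTrans_of_trans hc t).evAfter hc
    (j := j) (α := α) (l := l) (β := β)
  obtain ⟨k, f, ⟨⟨⟨⟨t, a⟩, b⟩, a'⟩, b'⟩⟩ := ((((ev t).and (ev a)).and (ev b)).and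
    (ev a')).and (ev b') |>.exists
  rw [List.map_append] at t
  have := hF k (by simpa using h₁) (by simpa using h₂) t a b a' b'
  rw [← onState_w f, this, onState_w]

end WHDTS

end Filtered

end HDA

namespace HDA

/-! ## Local presentability -/

variable {Lab : Type u}

/-- The functor of `n`-cubes. -/
noncomputable def cellFunctor (Lab : Type u) (n : ℕ) : LabSymPrecubicalSet Lab ⥤ Type u :=
  Over.forget _ ⋙ (evaluation _ _).obj (op (Box.mk n))

noncomputable instance (n : ℕ) : PreservesColimitsOfSize.{u, u} (cellFunctor Lab n) := by
  unfold cellFunctor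
  infer_instance

/-! ### Closure of `isHDAhdts` under filtered colimits, and finite presentability of labelled cubes.
-/

section Filtered

variable {J : Type u} [SmallCategory J] {F : J ⥤ LabSymPrecubicalSet Lab} {c : Cocone F}

theorem cell_w {i j : J} (f : i ⟶ j) {n : ℕ} (x : Cell (F.obj i) n) :
    (x.map (F.map f)).map (c.ι.app j) = x.map (c.ι.app i) := by
  rw [← Cell.map_comp, c.w]

variable [IsFiltered J]

theorem evAfter_cell_eq (hc : IsColimit c) {n : ℕ} {j : J} {x y : Cell (F.obj j) n}
    (h : x.map (c.ι.app j) = y.map (c.ι.app j)) :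
    EvAfter j fun _ f => x.map (F.map f) = y.map (F.map f) :=
  evAfter_map_eq (isColimitOfPreserves (cellFunctor Lab n) hc) h

theorem separated_of_isColimit (hc : IsColimit c) (hF : ∀ j, Separated (F.obj j)) :
    Separated c.pt := by
  intro n x y hl hv
  obtain ⟨j, x, y, rfl, rfl⟩ := Types.FilteredColimit.jointly_surjective_of_isColimit₂
    (isColimitOfPreserves (cellFunctor Lab n) hc) x y
  change Cell (F.obj j) n at x y
  change Cell.map (c.ι.app j) x = Cell.map (c.ι.app j) y
  change (Cell.map (c.ι.app j) x).lab = (Cell.map (c.ι.app j) y).lab at hl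
  change (Cell.map (c.ι.app j) x).vert = (Cell.map (c.ι.app j) y).vert at hv
  rw [Cell.lab_map, Cell.lab_map] at hl
  have := EvAfter.forall fun ε : Vertex n => evAfter_cell_eq hc (x := x.vert ε) (y := y.vert ε) (by
    rw [← Cell.vert_map, ← Cell.vert_map, hv])
  obtain ⟨k, f, h⟩ := this.exists
  rw [← cell_w f, ← cell_w f]
  congr 1
  refine hF k n _ _ (by rw [Cell.lab_map, Cell.lab_map, hl]) (funext fun ε => ?_)
  rw [Cell.vert_map, Cell.vert_map, h]

/-- The realization, being a left adjoint, carries the colimit to a filtered colimit of systems, so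
both halves of `isHDAhdts_iff` pass to it. -/
instance : (isHDAhdts Lab).IsClosedUnderColimitsOfShape J where
  colimitsOfShape_le := fun Z ⟨p⟩ => by
    have := (realAdj Lab).isLeftAdjoint
    refine isHDAhdts_iff.2 ⟨separated_of_isColimit p.isColimit fun j =>
      (isHDAhdts_iff.1 (p.prop_diag_obj j)).1, ?_⟩
    exact WHDTS.uniqueIntermediate_of_isColimit
      (isColimitOfPreserves (realization Lab) p.isColimit) fun j =>
        (isHDAhdts_iff.1 (p.prop_diag_obj j)).2

/-- By Yoneda, maps out of a labelled cube are cells with prescribed labels. Cells are computed by a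
colimit-preserving functor, and maps of the diagram do not change labels. -/
noncomputable instance (A : LabCube Lab) :
    PreservesColimitsOfShape J (coyoneda.obj (op ((labCubeFunctor Lab).obj A))) where
  preservesColimit {F} :=
    { preserves := fun {c} hc => by
        have hc' := isColimitOfPreserves (cellFunctor Lab A.dim) hc
        refine ⟨Types.FilteredColimit.isColimitOf _ _ (fun h => ?_) (fun i j h h' e => ?_)⟩
        · change (labCubeFunctor Lab).obj A ⟶ c.pt at h
          obtain ⟨j, x, hx⟩ := Types.jointly_surjective_of_isColimit hc' (Cell.ofHom h)
          change Cell (F.obj j) A.dim at x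
          change x.map (c.ι.app j) = _ at hx
          refine ⟨j, x.toHom (a := A.label) fun i => ?_, ?_⟩
          · rw [← Cell.lab_map (c.ι.app j), hx, Cell.lab_ofHom]
          · refine Cell.ofHom_injective (hx.symm.trans ?_)
            exact (congrArg (Cell.map (c.ι.app j)) (Cell.ofHom_toHom x _)).symm
        · change (labCubeFunctor Lab).obj A ⟶ F.obj i at h
          change (labCubeFunctor Lab).obj A ⟶ F.obj j at h'
          change h ≫ c.ι.app i = h' ≫ c.ι.app j at e
          have e' : (cellFunctor Lab A.dim).map (c.ι.app i) (Cell.ofHom h) =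
            (cellFunctor Lab A.dim).map (c.ι.app j) (Cell.ofHom h') := congrArg Cell.ofHom e
          obtain ⟨k, f, g, e⟩ := (Types.FilteredColimit.isColimit_eq_iff _ hc').1 e'
          exact ⟨k, f, g, Cell.ofHom_injective e⟩ }

end Filtered

attribute [local instance] Cardinal.fact_isRegular_aleph0

/-- Maps out of labelled cubes detect cells: a monomorphism is injective on cells, and lifting every
labelled cube makes it surjective. -/
theorem isStrongGenerator_labCube (Lab : Type u) :
    (ObjectProperty.ofObj (labCubeFunctor Lab).obj).IsStrongGenerator := by
  refine ObjectProperty.isStrongGenerator_iff.2 ⟨fun K K' f g h => lab_hom_ext fun n x => ?_,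
    fun K K' f _ h => (isIso_iff_cells f).2 fun n => ?_⟩
  · have := h _ (ObjectProperty.ofObj_apply _ ⟨n, x.lab⟩) (x.toHom fun _ => rfl)
    have := congrArg Cell.ofHom this
    rwa [Cell.ofHom_comp, Cell.ofHom_comp, Cell.ofHom_toHom] at this
  · refine ⟨fun x y e => ?_, fun y => ?_⟩
    · have hl : y.lab = x.lab := by rw [← Cell.lab_map f, ← e, Cell.lab_map]
      have : x.toHom (a := x.lab) (fun _ => rfl) = y.toHom (a := x.lab) (congrFun hl) := by
        rw [← cancel_mono f]
        refine Cell.ofHom_injective ?_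
        rw [Cell.ofHom_comp, Cell.ofHom_comp, Cell.ofHom_toHom, Cell.ofHom_toHom, e]
      simpa only [Cell.ofHom_toHom] using congrArg Cell.ofHom this
    · obtain ⟨g, hg⟩ := h _ (ObjectProperty.ofObj_apply _ ⟨n, y.lab⟩) (y.toHom fun _ => rfl)
      refine ⟨Cell.ofHom g, ?_⟩
      rw [← Cell.ofHom_comp]
      exact (congrArg Cell.ofHom hg).trans (Cell.ofHom_toHom y _)

instance (Lab : Type u) : IsLocallyFinitelyPresentable.{u} (LabSymPrecubicalSet Lab) := by
  refine (IsCardinalLocallyPresentable.iff_exists_isStrongGenerator _ _).2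
    ⟨_, inferInstance, isStrongGenerator_labCube Lab, ?_⟩
  rintro _ ⟨A⟩
  refine (isCardinalPresentable_iff _ _).2 ⟨fun J _ _ => ?_⟩
  have := isFiltered_of_isCardinalFiltered J Cardinal.aleph0.{u}
  infer_instance

theorem isLocallyFinitelyPresentable_isHDAhdts (Lab : Type u) :
    IsLocallyFinitelyPresentable.{u} (isHDAhdts Lab).FullSubcategory := by
  have := isRightAdjoint_ι Lab
  have : (isHDAhdts Lab).ι.IsCardinalAccessible Cardinal.aleph0.{u} := ⟨fun J _ _ => by
    have := isFiltered_of_isCardinalFiltered J Cardinal.aleph0.{u}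
    infer_instance⟩
  -- A reflective subcategory with finitary inclusion inherits local finite presentability from the
  -- ambient category.
  exact (Adjunction.ofIsRightAdjoint (isHDAhdts Lab).ι).isCardinalLocallyPresentable _

end HDA

namespace HDA

/-! ## Cubification -/

variable {Lab : Type u} {X Y : WHDTS Lab} {m n : ℕ}

/-- The labelled cubes as objects of the category of cubes. -/
def cubeObj (a : Fin n → Lab) : WHDTSCube Lab := (⟨n, a⟩ : Σ n : ℕ, Fin n → Lab)

/-- The dimension of a cube. -/
def cubeDim (A : WHDTSCube Lab) : ℕ := Sigma.fst (β := fun n => Fin n → Lab) A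

/-- The labels of a cube. -/
def cubeLabel (A : WHDTSCube Lab) : Fin (cubeDim A) → Lab :=
  Sigma.snd (β := fun n => Fin n → Lab) A

/-- The diagram whose colimit is the cubification. -/
abbrev cubDiagram (X : WHDTS Lab) : CostructuredArrow (whdtsCubeInclusion Lab) X ⥤ WHDTS Lab :=
  CostructuredArrow.proj (whdtsCubeInclusion Lab) X ⋙ whdtsCubeInclusion Lab

/-- The colimit cocone which defines the cubification. -/
noncomputable def cubCocone (X : WHDTS Lab) : Cocone (cubDiagram X) :=
  ⟨(cub Lab).obj X, (colimit.cocone (cubDiagram X)).ι⟩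

/-- The cubification is a colimit. -/
noncomputable def cubIsColimit (X : WHDTS Lab) : IsColimit (cubCocone X) :=
  colimit.isColimit (cubDiagram X)

/-- The cubes of the colimit given by the cocone. -/
noncomputable def cubLeg (j : CostructuredArrow (whdtsCubeInclusion Lab) X) :
    CubeIn ((cub Lab).obj X) (cubeDim j.left) :=
  CubeIn.ofHom ((cubCocone X).ι.app j)

/-- The cube of `X` given by an index of the diagram. -/
def cubIndex (j : CostructuredArrow (whdtsCubeInclusion Lab) X) :
    CubeIn X (cubeDim j.left) :=
  CubeIn.ofHom j.hom

/-- The index of the diagram which is given by a cube of `X`. -/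
def cubArrow (x : CubeIn X n) : CostructuredArrow (whdtsCubeInclusion Lab) X :=
  CostructuredArrow.mk (Y := cubeObj fun i => X.label (x.act i))
    (x.toHom fun _ => rfl)

/-- As for the realization, an equality of cubes supplies a morphism of the indexing category. Only
the maps of cubes induced by some `BoxHom` are needed. -/
theorem cubLeg_eq_res (j k : CostructuredArrow (whdtsCubeInclusion Lab) X)
    (f : BoxHom (cubeDim j.left) (cubeDim k.left))
    (h : cubIndex j = (cubIndex k).res f) : cubLeg j = (cubLeg k).res f := by
  let φ : j.left ⟶ k.left := InducedCategory.homMk ((cubeRealization Lab).map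
    (X := ⟨_, cubeLabel j.left⟩) (Y := ⟨_, cubeLabel k.left⟩) ⟨f, fun i =>
      (CubeIn.label_ofHom (a := cubeLabel k.left) k.hom (f.dir i)).symm.trans
        ((congrArg X.label (congrFun (congrArg CubeIn.act h) i).symm).trans
          (CubeIn.label_ofHom (a := cubeLabel j.left) j.hom i))⟩)
  have hφ : (whdtsCubeInclusion Lab).map φ ≫ k.hom = j.hom :=
    CubeIn.ofHom_injective h.symm
  exact congrArg CubeIn.ofHom ((cubCocone X).w (CostructuredArrow.homMk φ hφ)).symm

/-- The cube of the cubification given by a cube of `X`. -/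
noncomputable def cubCell (x : CubeIn X n) : CubeIn ((cub Lab).obj X) n := cubLeg (cubArrow x)

theorem cubLeg_eq (j : CostructuredArrow (whdtsCubeInclusion Lab) X) :
    cubLeg j = cubCell (cubIndex j) :=
  (cubLeg_eq_res j (cubArrow _) (BoxHom.id _) (CubeIn.res_id _).symm).trans
    (CubeIn.res_id (cubCell _))

theorem cubCell_res (f : BoxHom m n) (x : CubeIn X n) : cubCell (x.res f) = (cubCell x).res f :=
  cubLeg_eq_res (cubArrow _) (cubArrow x) f rfl

/-- The cocone of the cubes of `X`. -/
def cubCounitCocone (X : WHDTS Lab) : Cocone (cubDiagram X) where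
  pt := X
  ι :=
    { app := fun j => j.hom
      naturality := fun _ _ f => (CostructuredArrow.w f).trans (Category.comp_id _).symm }

/-- The map `cub(X) ⟶ X`. -/
noncomputable def cubCounit (X : WHDTS Lab) : (cub Lab).obj X ⟶ X :=
  (cubIsColimit X).desc (cubCounitCocone X)

theorem map_cubCounit (x : CubeIn X n) : (cubCell x).map (cubCounit X) = x :=
  congrArg CubeIn.ofHom ((cubIsColimit X).fac (cubCounitCocone X) (cubArrow x))

theorem ι_cub_map (f : X ⟶ Y) (j : CostructuredArrow (whdtsCubeInclusion Lab) X) :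
    (cubCocone X).ι.app j ≫ (cub Lab).map f =
      (cubCocone Y).ι.app ((CostructuredArrow.map f).obj j) :=
  colimit.ι_desc (F := cubDiagram X) _ j

theorem ι_cub_map_comp {Z : WHDTS Lab} (f : X ⟶ Y)
    (j : CostructuredArrow (whdtsCubeInclusion Lab) X) (h : (cub Lab).obj Y ⟶ Z) :
    (cubCocone X).ι.app j ≫ (cub Lab).map f ≫ h =
      (cubCocone Y).ι.app ((CostructuredArrow.map f).obj j) ≫ h :=
  (Category.assoc _ _ _).symm.trans (congrArg (· ≫ h) (ι_cub_map f j))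

theorem cubCounit_naturality (f : X ⟶ Y) :
    (cub Lab).map f ≫ cubCounit Y = cubCounit X ≫ f := by
  refine (cubIsColimit X).hom_ext fun j => ?_
  refine (ι_cub_map_comp f j (cubCounit Y)).trans ?_
  refine ((cubIsColimit Y).fac (cubCounitCocone Y) _).trans ?_
  refine (congrArg (· ≫ f) ((cubIsColimit X).fac (cubCounitCocone X) j).symm).trans ?_
  exact Category.assoc _ _ _

/-- The cubes of the cubification which come from cubes of `X`. -/
def cubCubes (X : WHDTS Lab) (n : ℕ) : Set (CubeIn ((cub Lab).obj X) n) :=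
  Set.range (cubCell (X := X))

theorem cub_induction (PS : ((cub Lab).obj X).State → Prop)
    (PT : ((cub Lab).obj X).State → List ((cub Lab).obj X).Action →
      ((cub Lab).obj X).State → Prop)
    (hS : ∀ x : CubeIn X 0, PS ((cubCell x).vert Fin.elim0))
    (hT : ∀ α l β, WHDTS.FromCubes (cubCubes X) α l β → PT α l β)
    (hm : ∀ α l l' β, l.Perm l' → PT α l β → PT α l' β)
    (hcoh : ∀ α β ν₁ ν₂ l₁ l₂ l₃, l₁ ≠ [] → l₂ ≠ [] → l₃ ≠ [] → PT α (l₁ ++ l₂ ++ l₃) β →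
      PT α l₁ ν₁ → PT ν₁ (l₂ ++ l₃) β → PT α (l₁ ++ l₂) ν₂ → PT ν₂ l₃ β → PT ν₁ l₂ ν₂) :
    (∀ s, PS s) ∧ ∀ α l β, ((cub Lab).obj X).trans α l β → PT α l β := by
  have := WHDTS.colimit_induction (cubIsColimit X) PS (fun _ => True) PT
    (fun j s => by
      have h := congrFun (congrArg CubeIn.vert
        (cubCell_res (BoxHom.vertex s.down) (cubIndex j))) Fin.elim0
      have h' := hS ((cubIndex j).res (BoxHom.vertex s.down))
      rw [h] at h'
      exact (congrArg (fun x => PS ((CubeIn.res (BoxHom.vertex s.down) x).vert Fin.elim0))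
        (cubLeg_eq j)).mpr h')
    (fun _ _ => trivial)
    (fun j α l β h => hT _ _ _ ⟨_, cubLeg j, ⟨_, (cubLeg_eq j).symm⟩, α.down, l.map ULift.down,
      β.down, CubeIn.cubeTrans_of_trans h, rfl, List.map_map, rfl⟩)
    hm hcoh
  exact ⟨this.1, this.2.2⟩

theorem exists_cubCell_vert (s : ((cub Lab).obj X).State) :
    ∃ x : CubeIn X 0, (cubCell x).vert Fin.elim0 = s :=
  (cub_induction (fun s => ∃ x : CubeIn X 0, (cubCell x).vert Fin.elim0 = s)
    (fun _ _ _ => True) (fun x => ⟨x, rfl⟩) (fun _ _ _ _ => trivial) (fun _ _ _ _ _ _ => trivial)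
    (fun _ _ _ _ _ _ _ _ _ _ _ _ _ _ _ => trivial)).1 s

theorem CubeIn.ext_zero {x y : CubeIn X 0} (h : x.vert Fin.elim0 = y.vert Fin.elim0) : x = y :=
  CubeIn.ext (funext fun ε => by rwa [Subsingleton.elim ε Fin.elim0]) (funext fun i => i.elim0)

/-- Every state of `cub X` comes from a `0`-cube of `X`, which the counit sends back to its own
state. -/
theorem onState_cubCounit_injective : Function.Injective (cubCounit X).onState := by
  intro s t h
  obtain ⟨x, rfl⟩ := exists_cubCell_vert s
  obtain ⟨y, rfl⟩ := exists_cubCell_vert t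
  have hx := congrFun (congrArg CubeIn.vert (map_cubCounit x)) Fin.elim0
  have hy := congrFun (congrArg CubeIn.vert (map_cubCounit y)) Fin.elim0
  rw [CubeIn.ext_zero (hx.symm.trans (h.trans hy))]

/-- The cubes of `cub(X)` are those of `X`. -/
theorem isIso_nerve_map_cubCounit (hX : X.UniqueIntermediate) :
    IsIso ((nerve Lab).map (cubCounit X)) := by
  have hU : ((cub Lab).obj X).UniqueIntermediate :=
    hX.of_hom (cubCounit X) onState_cubCounit_injective
  have hC : ∀ α l β, ((cub Lab).obj X).trans α l β → WHDTS.FromCubes (cubCubes X) α l β :=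
    (cub_induction (fun _ => True) (WHDTS.FromCubes (cubCubes X)) (fun _ => trivial)
      (fun _ _ _ h => h) (fun _ _ _ _ hp h => h.multiset hp)
      (fun _ _ _ _ _ _ _ h₁ h₂ h₃ t t₁ t₂ t₃ t₄ => WHDTS.FromCubes.coherence hU h₁ h₂ h₃
        t t₁ t₂ t₃ t₄)).2
  have key : ∀ {n} (c : CubeIn ((cub Lab).obj X) n), ∃ x : CubeIn X n, cubCell x = c := by
    intro n c
    obtain rfl | hn := eq_or_ne n 0
    · obtain ⟨x, hx⟩ := exists_cubCell_vert (c.vert Fin.elim0)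
      exact ⟨x, CubeIn.ext_zero hx⟩
    · exact hU.mem_of_fromCubes hC
        (by rintro m n f _ ⟨x, rfl⟩; exact ⟨x.res f, cubCell_res f x⟩) hn c
  refine (isIso_iff_cells _).2 fun n => ⟨fun c d h => ?_, fun x => ⟨_, map_cubCounit x⟩⟩
  obtain ⟨x, rfl⟩ := key c
  obtain ⟨y, rfl⟩ := key d
  exact congrArg _ ((map_cubCounit x).symm.trans (h.trans (map_cubCounit y)))

/-- A map which induces bijections on cubes induces an isomorphism of cubifications. -/
theorem isIso_cub_map (f : X ⟶ Y)
    (hf : ∀ n, Function.Bijective (CubeIn.map f : CubeIn X n → CubeIn Y n)) :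
    IsIso ((cub Lab).map f) := by
  -- Bijectivity on cubes makes every cube of `Y` lift uniquely to `X`. The chosen lifts form a
  -- cocone over the diagram of `Y`, which yields the inverse.
  have hf' : ∀ j : CostructuredArrow (whdtsCubeInclusion Lab) Y,
      ∃ g : (whdtsCubeInclusion Lab).obj j.left ⟶ X, g ≫ f = j.hom := by
    intro j
    obtain ⟨x, hx⟩ := (hf _).2 (cubIndex j)
    refine ⟨x.toHom (a := cubeLabel j.left) fun i => ?_,
      CubeIn.ofHom_injective hx⟩
    exact (f.label_eq (x.act i)).symm.trans
      ((congrArg Y.label (congrFun (congrArg CubeIn.act hx) i)).trans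
        (CubeIn.label_ofHom (a := cubeLabel j.left) j.hom i))
  choose g hg using hf'
  have hinj : ∀ {A : WHDTSCube Lab} {g g' : (whdtsCubeInclusion Lab).obj A ⟶ X},
      g ≫ f = g' ≫ f → g = g' := fun e => CubeIn.ofHom_injective ((hf _).1 (congrArg CubeIn.ofHom e))
  let s : Cocone (cubDiagram Y) :=
    { pt := (cub Lab).obj X
      ι :=
        { app := fun j => (cubCocone X).ι.app (CostructuredArrow.mk (g j))
          naturality := fun j k φ => by
            have e : (whdtsCubeInclusion Lab).map φ.left ≫ g k = g j := hinj (by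
              rw [Category.assoc, hg, hg, CostructuredArrow.w])
            exact ((cubCocone X).w (CostructuredArrow.homMk (f := CostructuredArrow.mk (g j))
              (f' := CostructuredArrow.mk (g k)) φ.left e)).trans (Category.comp_id _).symm } }
  refine ⟨(cubIsColimit Y).desc s, (cubIsColimit X).hom_ext fun j => ?_,
    (cubIsColimit Y).hom_ext fun j => ?_⟩
  · refine (ι_cub_map_comp f j _).trans (((cubIsColimit Y).fac s _).trans ?_)
    have e : g ((CostructuredArrow.map f).obj j) = j.hom := hinj (hg _)
    change (cubCocone X).ι.app (CostructuredArrow.mk (g ((CostructuredArrow.map f).obj j))) = _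
    rw [e]
    exact (Category.comp_id _).symm
  · have h1 := (cubIsColimit Y).fac s j
    refine (Category.assoc _ _ _).symm.trans ((congrArg (· ≫ (cub Lab).map f) h1).trans ?_)
    refine (ι_cub_map f (CostructuredArrow.mk (g j))).trans ?_
    have e : ∀ h : (whdtsCubeInclusion Lab).obj j.left ⟶ Y, h = j.hom →
        (cubCocone Y).ι.app (CostructuredArrow.mk h) = (cubCocone Y).ι.app j := by
      rintro _ rfl
      rfl
    exact (e (g j ≫ f) (hg j)).trans (Category.comp_id _).symm

/-- A map of higher dimensional transition systems induces an isomorphism of cubifications if and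
only if it induces an isomorphism of nerves. -/
theorem isIso_cub_map_iff (f : X ⟶ Y) (hX : X.UniqueIntermediate) (hY : Y.UniqueIntermediate) :
    IsIso ((cub Lab).map f) ↔ IsIso ((nerve Lab).map f) := by
  refine ⟨fun _ => ?_, fun h => isIso_cub_map f ((isIso_iff_cells _).1 h)⟩
  have := isIso_nerve_map_cubCounit hX
  have := isIso_nerve_map_cubCounit hY
  -- Two out of three in the naturality square of the counit, whose nerve is invertible at both
  -- ends.
  have e : (nerve Lab).map (cubCounit X) ≫ (nerve Lab).map f =
      (nerve Lab).map ((cub Lab).map f) ≫ (nerve Lab).map (cubCounit Y) := by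
    rw [← Functor.map_comp, ← Functor.map_comp, cubCounit_naturality]
  have : IsIso ((nerve Lab).map (cubCounit X) ≫ (nerve Lab).map f) := e ▸ inferInstance
  exact IsIso.of_isIso_comp_left ((nerve Lab).map (cubCounit X)) _

end HDA

namespace HDA

/-! ## The categorical localization -/

variable {Lab : Type u}

/-- The nerve functor from higher dimensional transition systems to `HDA_hdts`. -/
noncomputable def nerveHDTS (Lab : Type u) : HDTS Lab ⥤ (isHDAhdts Lab).FullSubcategory :=
  (isHDAhdts Lab).lift ((isHDTS Lab).ι ⋙ nerve Lab) fun X => isHDAhdts_nerve X.property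

/-- The adjunction between `HDA_hdts` and higher dimensional transition systems. -/
noncomputable def realAdjHDTS (Lab : Type u) : realizationHDTS Lab ⊣ nerveHDTS Lab :=
  Adjunction.mkOfUnitCounit
    { unit :=
        { app := fun K => ObjectProperty.homMk ((realAdj Lab).unit.app K.obj)
          naturality := fun _ _ f =>
            ObjectProperty.hom_ext _ ((realAdj Lab).unit.naturality f.hom) }
      counit :=
        { app := fun X => ObjectProperty.homMk ((realAdj Lab).counit.app X.obj)
          naturality := fun _ _ f =>
            ObjectProperty.hom_ext _ ((realAdj Lab).counit.naturality f.hom) }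
      left_triangle := NatTrans.ext (funext fun K => ObjectProperty.hom_ext _
        ((congrArg _ (Category.id_comp _)).trans
          ((realAdj Lab).left_triangle_components K.obj)))
      right_triangle := NatTrans.ext (funext fun X => ObjectProperty.hom_ext _
        ((congrArg _ (Category.id_comp _)).trans
          ((realAdj Lab).right_triangle_components X.obj))) }

/-- An invertible unit makes the left adjoint fully faithful, so that its right adjoint is a
localization. -/
instance : IsIso (realAdjHDTS Lab).unit := by
  refine (NatTrans.isIso_iff_isIso_app _).2 fun K => ?_
  have : IsIso ((isHDAhdts Lab).ι.map ((realAdjHDTS Lab).unit.app K)) :=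
    isIso_realUnit K.property
  exact isIso_of_reflects_iso _ (isHDAhdts Lab).ι

instance : (realizationHDTS Lab).Full := (realAdjHDTS Lab).fullyFaithfulLOfIsIsoUnit.full

instance : (realizationHDTS Lab).Faithful := (realAdjHDTS Lab).fullyFaithfulLOfIsIsoUnit.faithful

theorem cubIso_eq (Lab : Type u) : cubIso Lab =
    (MorphismProperty.isomorphisms _).inverseImage (nerveHDTS Lab) := by
  ext X Y f
  refine (isIso_cub_map_iff f.hom X.property.2.1.uniqueIntermediate
    Y.property.2.1.uniqueIntermediate).trans ?_
  exact isIso_iff_of_reflects_iso ((nerveHDTS Lab).map f) (isHDAhdts Lab).ι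

instance : (nerveHDTS Lab).IsLocalization (cubIso Lab) := by
  rw [cubIso_eq]
  exact (realAdjHDTS Lab).isLocalization'

/-- The localization `Q` and the nerve invert the same maps universally, so they differ by an
equivalence. Through it the composite becomes realization followed by nerve, which the unit
identifies with the identity. -/
theorem isEquivalence_realizationHDTS (Lab : Type u) :
    (realizationHDTS Lab ⋙ (cubIso Lab).Q).IsEquivalence := by
  let e := Localization.uniq (cubIso Lab).Q (nerveHDTS Lab) (cubIso Lab)
  have i : (realizationHDTS Lab ⋙ (cubIso Lab).Q) ⋙ e.functor ≅ 𝟭 _ :=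
    Functor.associator _ _ _ ≪≫ Functor.isoWhiskerLeft _ (Localization.compUniqFunctor _ _ _) ≪≫
      (asIso (realAdjHDTS Lab).unit).symm
  have : ((realizationHDTS Lab ⋙ (cubIso Lab).Q) ⋙ e.functor).IsEquivalence :=
    Functor.isEquivalence_of_iso i.symm
  exact Functor.isEquivalence_of_comp_right _ e.functor

/-- Two systems are isomorphic in the localization if and only if their nerves are isomorphic. -/
theorem nonempty_iso_iff (X Y : HDTS Lab) :
    Nonempty ((cubIso Lab).Q.obj X ≅ (cubIso Lab).Q.obj Y) ↔
      Nonempty ((nerve Lab).obj X.obj ≅ (nerve Lab).obj Y.obj) := by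
  let e := Localization.uniq (cubIso Lab).Q (nerveHDTS Lab) (cubIso Lab)
  let i : (cubIso Lab).Q ⋙ e.functor ≅ nerveHDTS Lab := Localization.compUniqFunctor _ _ _
  constructor
  · rintro ⟨f⟩
    exact ⟨(isHDAhdts Lab).ι.mapIso ((i.app X).symm ≪≫ e.functor.mapIso f ≪≫ i.app Y)⟩
  · rintro ⟨f⟩
    exact ⟨e.functor.preimageIso (i.app X ≪≫
      ((isHDAhdts Lab).fullyFaithfulι.preimageIso
        (X := (nerveHDTS Lab).obj X) (Y := (nerveHDTS Lab).obj Y) f) ≪≫ (i.app Y).symm)⟩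

/-! ## Comparison of the cubes -/

section SameCubes

variable {X Y : WHDTS Lab} {n : ℕ}

/-- The cube of dimension `0` given by a state. -/
def CubeIn.point (s : X.State) : CubeIn X 0 where
  vert _ := s
  act i := i.elim0
  map_trans _ _ _ h := absurd (List.eq_nil_iff_forall_not_mem.2 fun i => i.elim0) h.1

/-- The map on cubes induced by a map of nerves. -/
noncomputable def cubeMap (g : (nerve Lab).obj X ⟶ (nerve Lab).obj Y) (x : CubeIn X n) : CubeIn Y n :=
  Cell.map (K := nerveObj X) (K' := nerveObj Y) g x

/-- The map on states induced by a map of nerves. -/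
noncomputable def stateMap (g : (nerve Lab).obj X ⟶ (nerve Lab).obj Y) (s : X.State) : Y.State :=
  (cubeMap g (CubeIn.point s)).vert Fin.elim0

/-- Compatibility with the vertex faces means that a map of nerves acts on the vertices of all cubes
through one map of states. -/
theorem vert_cubeMap (g : (nerve Lab).obj X ⟶ (nerve Lab).obj Y) (x : CubeIn X n)
    (ε : Vertex n) : (cubeMap g x).vert ε = stateMap g (x.vert ε) := by
  have h : cubeMap g (x.res (BoxHom.vertex ε)) = (cubeMap g x).res (BoxHom.vertex ε) :=
    Cell.map_res (K := nerveObj X) (K' := nerveObj Y) g (BoxHom.vertex ε) x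
  have e : x.res (BoxHom.vertex ε) = CubeIn.point (x.vert ε) := CubeIn.ext_zero rfl
  rw [e] at h
  exact (congrFun (congrArg CubeIn.vert h) Fin.elim0).symm

theorem exists_cube_of_nerve (g : (nerve Lab).obj X ⟶ (nerve Lab).obj Y) {a : Fin n → Lab}
    (c : WHDTS.cube a ⟶ X) :
    ∃ d : WHDTS.cube a ⟶ Y, ∀ ε, d.onState ⟨ε⟩ = stateMap g (c.onState ⟨ε⟩) :=
  ⟨(cubeMap g (CubeIn.ofHom c)).toHom fun i =>
    (congrFun (Cell.lab_map (K := nerveObj X) (K' := nerveObj Y) g (CubeIn.ofHom c)) i).trans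
      (CubeIn.label_ofHom c i), vert_cubeMap g (CubeIn.ofHom c)⟩

theorem stateMap_inv_hom (e : (nerve Lab).obj X ≅ (nerve Lab).obj Y) (s : X.State) :
    stateMap e.inv (stateMap e.hom s) = s := by
  have h : cubeMap e.inv (cubeMap e.hom (CubeIn.point s)) = CubeIn.point s :=
    (Cell.map_comp (K := nerveObj X) e.hom e.inv _).symm.trans
      (congrArg (fun g => Cell.map g _) e.hom_inv_id)
  refine (vert_cubeMap e.inv _ _).symm.trans ?_
  rw [h]
  rfl

theorem sameCubes_of_iso (e : (nerve Lab).obj X ≅ (nerve Lab).obj Y) : X.SameCubes Y := by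
  have h₁ := stateMap_inv_hom e
  have h₂ : ∀ s, stateMap e.hom (stateMap e.inv s) = s := stateMap_inv_hom e.symm
  refine ⟨⟨stateMap e.hom, stateMap e.inv, h₁, h₂⟩, fun n a g => ⟨?_, ?_⟩⟩
  · rintro ⟨c, hc⟩
    obtain ⟨d, hd⟩ := exists_cube_of_nerve e.hom c
    exact ⟨d, fun ε => by rw [hd, hc]; rfl⟩
  · rintro ⟨c, hc⟩
    obtain ⟨d, hd⟩ := exists_cube_of_nerve e.inv c
    exact ⟨d, fun ε => by rw [hd, hc]; exact h₁ _⟩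

/-- The hypothesis only gives, for each cube, some cube over the transported vertices. CSA1 in `Y`
makes it unique, so the choices are compatible with faces; CSA1 in `X` gives injectivity. -/
theorem nonempty_iso_of_sameCubes (hX : X.CSA1) (hY : Y.CSA1) (h : X.SameCubes Y) :
    Nonempty ((nerve Lab).obj X ≅ (nerve Lab).obj Y) := by
  obtain ⟨φ, hφ⟩ := h
  have key : ∀ n (x : CubeIn X n), ∃ y : CubeIn Y n, (∀ ε, y.vert ε = φ (x.vert ε)) ∧
      ∀ i, Y.label (y.act i) = X.label (x.act i) := by
    intro n x
    obtain ⟨d, hd⟩ := (hφ n _ x.vert).1 ⟨x.toHom fun _ => rfl, fun _ => rfl⟩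
    exact ⟨CubeIn.ofHom d, hd, CubeIn.label_ofHom d⟩
  choose f hf hl using key
  let g : (nerve Lab).obj X ⟶ (nerve Lab).obj Y :=
    homOfCells (K := nerveObj X) (K' := nerveObj Y) f
      (fun m n b x => by
        refine hY.cube_ext (x := f m (CubeIn.res b x)) (y := CubeIn.res b (f n x))
          (funext fun ε => ?_) fun i => ?_
        · exact (hf _ _ ε).trans (hf _ x _).symm
        · exact (hl _ _ i).trans (hl _ x _).symm)
      (fun n x => funext (hl n x))
  have : IsIso g := (isIso_iff_cells _).2 fun n => by
    refine ⟨fun x y e => ?_, fun y => ?_⟩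
    · change f n x = f n y at e
      refine hX.cube_ext (x := x) (y := y) (funext fun ε => φ.injective ?_) fun i => ?_
      · exact (hf n x ε).symm.trans ((congrFun (congrArg CubeIn.vert e) ε).trans (hf n y ε))
      · exact (hl n x i).symm.trans
          ((congrArg Y.label (congrFun (congrArg CubeIn.act e) i)).trans (hl n y i))
    · change CubeIn Y n at y
      obtain ⟨c, hc⟩ := (hφ n _ fun ε => φ.symm (y.vert ε)).2
        ⟨y.toHom fun _ => rfl, fun ε => (φ.apply_symm_apply _).symm⟩
      refine ⟨CubeIn.ofHom c, hY.cube_ext (x := f n (CubeIn.ofHom c)) (y := y)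
        (funext fun ε => ?_) fun i => ?_⟩
      · rw [hf]
        exact (congrArg φ (hc ε)).trans (φ.apply_symm_apply _)
      · rw [hl]
        exact CubeIn.label_ofHom c i
  exact ⟨asIso g⟩

/-! ### Removal of unused actions. -/

/-- The inclusion of the used part. -/
def usedPartι (X : WHDTS Lab) : X.usedPart ⟶ X where
  onState s := s
  onAction := Subtype.val
  label_eq _ := rfl
  map_trans _ _ _ h := h

/-- Cubes only involve used actions. -/
theorem exists_lift_usedPart {a : Fin n → Lab} (c : WHDTS.cube a ⟶ X) :
    ∃ c' : WHDTS.cube a ⟶ X.usedPart, ∀ ε, c'.onState ε = c.onState ε := by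
  -- Each action of a cube is used, namely by the edge in its direction at the initial vertex.
  refine ⟨⟨c.onState, fun i => ⟨c.onAction i, _, _, (CubeIn.ofHom c).edge i.down⟩, c.label_eq,
    fun α l β h => ?_⟩, fun _ => rfl⟩
  exact (congrArg (fun w => X.trans _ w _) List.map_map).mpr (c.map_trans _ _ _ h)

theorem sameCubes_of_usedPart (e : X.usedPart ≅ Y.usedPart) : X.SameCubes Y := by
  have h₁ : ∀ s, e.inv.onState (e.hom.onState s) = s :=
    congrFun (congrArg WHDTS.Hom.onState e.hom_inv_id)
  have h₂ : ∀ s, e.hom.onState (e.inv.onState s) = s :=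
    congrFun (congrArg WHDTS.Hom.onState e.inv_hom_id)
  refine ⟨⟨e.hom.onState, e.inv.onState, h₁, h₂⟩, fun n a g => ⟨?_, ?_⟩⟩
  · rintro ⟨c, hc⟩
    obtain ⟨c', hc'⟩ := exists_lift_usedPart c
    exact ⟨c' ≫ e.hom ≫ usedPartι Y, fun ε => congrArg e.hom.onState ((hc' _).trans (hc ε))⟩
  · rintro ⟨c, hc⟩
    obtain ⟨c', hc'⟩ := exists_lift_usedPart c
    exact ⟨c' ≫ e.inv ≫ usedPartι X, fun ε =>
      (congrArg e.inv.onState ((hc' _).trans (hc ε))).trans (h₁ _)⟩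

end SameCubes

theorem nonempty_iso_iff_sameCubes (X Y : HDTS Lab) :
    Nonempty ((cubIso Lab).Q.obj X ≅ (cubIso Lab).Q.obj Y) ↔ X.obj.SameCubes Y.obj :=
  (nonempty_iso_iff X Y).trans ⟨fun ⟨e⟩ => sameCubes_of_iso e,
    nonempty_iso_of_sameCubes X.property.1 Y.property.1⟩

end HDA

theorem mainTheorem3 (Lab : Type u) :
    (HDA.realizationHDTS Lab ⋙ (HDA.cubIso Lab).Q).IsEquivalence ∧
    (HDA.isHDAhdts Lab).ι.IsRightAdjoint ∧
    IsLocallyFinitelyPresentable.{u} (HDA.isHDAhdts Lab).FullSubcategory ∧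
    (∀ X Y : HDA.HDTS Lab,
      Nonempty ((HDA.cubIso Lab).Q.obj X ≅ (HDA.cubIso Lab).Q.obj Y) ↔ X.obj.SameCubes Y.obj) ∧
    (∀ X Y : HDA.HDTS Lab, Nonempty (X.obj.usedPart ≅ Y.obj.usedPart) →
      Nonempty ((HDA.cubIso Lab).Q.obj X ≅ (HDA.cubIso Lab).Q.obj Y)) :=
  ⟨HDA.isEquivalence_realizationHDTS Lab, HDA.isRightAdjoint_ι Lab,
    HDA.isLocallyFinitelyPresentable_isHDAhdts Lab, HDA.nonempty_iso_iff_sameCubes,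
    fun X Y ⟨e⟩ => (HDA.nonempty_iso_iff_sameCubes X Y).2 (HDA.sameCubes_of_usedPart e)⟩
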